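/- Let $(\Omega,\mathcal A,\mathbb P)$ be a probability space and let $X:\Omega\to\mathbb R^n$ be a random vector with Lebesgue density $\rho\ge 0$. Put $\mathcal X=\{x\in\mathbb R^n:\rho(x)>0\}$; assume that $\mathcal X$ is open with Lebesgue-null boundary, and that $\rho$ is bounded and continuous on $\mathcal X$. Suppose that one of the following two cases holds: 1. $\mathcal X$ is bounded and convex, and $X$ is uniformly distributed on $\mathcal X$; 2. $\mathcal X=\mathbb R^n$ and $X$ is standard Gaussian, $X\sim\mathcal N(0,I)$. Then there is a constant $C>0$, depending only on the law of $X$, such that the following holds. Let $f:\mathcal X\to\mathbb R$ be measurable, with partial derivatives existing at every point of $\mathcal X$ and square integrable with respect to $\rho$, i.e. $\int_{\mathcal X}(\partial_i f(x))^2\rho(x)\,dx<\infty$ for all $i$. Let $$\int_{\mathcal X}\nabla f(x)\,\nabla f(x)^\top\rho(x)\,dx=W\Lambda W^\top,\qquad \Lambda=\mathrm{diag}(\lambda_1,\dots,\lambda_n),\quad \lambda_1\ge\dots\ge\lambda_n,$$ be any orthogonal eigendecomposition, let $1\le k\le n-1$, and split $W=[W_1\;\;W_2]$ into its first $k$ and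 last $n-k$ columns. For $y\in\mathbb R^k$ and $z\in\mathbb R^{n-k}$ let $$\rho_Y(y)=\int_{\mathbb R^{n-k}}\rho(W_1y+W_2z)\,dz,\qquad \rho_{Z|Y}(z\,|\,y)=\frac{\rho(W_1y+W_2z)}{\rho_Y(y)}\ \text{ for } y\in W_1^\top\mathcal X,$$ with $\rho_{Z|Y}(\cdot\,|\,y)=0$ for $y\notin W_1^\top\mathcal X$, and let $$g(y)=\int_{\mathbb R^{n-k}}f(W_1y+W_2z)\,\rho_{Z|Y}(z\,|\,y)\,dz$$ be the conditional expectation of $f(X)$ given $W_1^\top X=y$ (set to $0$ where the integral does not converge absolutely). Then the integral defining $g(W_1^\top X)$ converges absolutely almost surely, $f(X)-g(W_1^\top X)$ is square integrable, and $$\mathbb E\Big[\big(f(X)-g(W_1^\top X)\big)^2\Big]\le C\,(\lambda_{k+1}+\dots+\lambda_n).$$ -/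

import Mathlib

open MeasureTheory ProbabilityTheory
open scoped Matrix

/-- The support `𝒳 = {x | ρ x > 0}` of a density `ρ` on `ℝⁿ`. -/
def densitySupport {n : ℕ} (ρ : EuclideanSpace ℝ (Fin n) → ℝ) : Set (EuclideanSpace ℝ (Fin n)) :=
  {x | 0 < ρ x}

/-- The regularity required of a density `ρ` on `ℝⁿ`: it is measurable and nonnegative, its
support `𝒳` is open with Lebesgue-null boundary, and `ρ` is bounded and continuous on `𝒳`. -/
structure IsRegularDensity {n : ℕ} (ρ : EuclideanSpace ℝ (Fin n) → ℝ) : Prop where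
  measurable : Measurable ρ
  nonneg : ∀ x, 0 ≤ ρ x
  isOpen_support : IsOpen (densitySupport ρ)
  volume_frontier : volume (frontier (densitySupport ρ)) = 0
  bounded : ∃ M : ℝ, ∀ x ∈ densitySupport ρ, ρ x ≤ M
  continuousOn : ContinuousOn ρ (densitySupport ρ)

/-- `f` has all (classical) partial derivatives at the point `x`. -/
def HasPartials {n : ℕ} (f : EuclideanSpace ℝ (Fin n) → ℝ) (x : EuclideanSpace ℝ (Fin n)) : Prop :=
  ∀ i : Fin n, LineDifferentiableAt ℝ f x (EuclideanSpace.single i (1 : ℝ))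

/-- The `i`-th partial derivative of `f` at `x`; these are the entries of `∇f(x)`. -/
noncomputable def partialDeriv {n : ℕ} (f : EuclideanSpace ℝ (Fin n) → ℝ) (i : Fin n)
    (x : EuclideanSpace ℝ (Fin n)) : ℝ :=
  lineDeriv ℝ f x (EuclideanSpace.single i (1 : ℝ))

/-- The matrix `C = ∫_𝒳 ∇f(x) ∇f(x)ᵀ ρ(x) dx`. -/
noncomputable def gradientMatrix {n : ℕ} (ρ f : EuclideanSpace ℝ (Fin n) → ℝ) :
    Matrix (Fin n) (Fin n) ℝ :=
  Matrix.of fun i j =>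
    ∫ x in densitySupport ρ, partialDeriv f i x * partialDeriv f j x * ρ x

/-- `C = W Λ Wᵀ` with `W` orthogonal and `Λ = diag(lam)`, the eigenvalues being in descending
order. -/
structure IsOrthogonalEigendecomposition {n : ℕ} (C W : Matrix (Fin n) (Fin n) ℝ)
    (lam : Fin n → ℝ) : Prop where
  orthogonal : W ∈ Matrix.orthogonalGroup (Fin n) ℝ
  antitone : Antitone lam
  eq_mul : C = W * Matrix.diagonal lam * Wᵀ

/-- `W₁`: the first `k` columns of `W`. -/
def activeColumns {n k : ℕ} (hk : k < n) (W : Matrix (Fin n) (Fin n) ℝ) :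
    Matrix (Fin n) (Fin k) ℝ :=
  Matrix.of fun i j => W i ⟨j, by omega⟩

/-- `W₂`: the last `n - k` columns of `W`. -/
def inactiveColumns {n k : ℕ} (hk : k < n) (W : Matrix (Fin n) (Fin n) ℝ) :
    Matrix (Fin n) (Fin (n - k)) ℝ :=
  Matrix.of fun i j => W i ⟨k + j, by omega⟩

/-- The active variable `y = W₁ᵀ x`. -/
noncomputable def activeVariable {n k : ℕ} (hk : k < n) (W : Matrix (Fin n) (Fin n) ℝ)
    (x : EuclideanSpace ℝ (Fin n)) : EuclideanSpace ℝ (Fin k) :=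
  WithLp.toLp 2 ((activeColumns hk W)ᵀ *ᵥ x.ofLp)

/-- The point `W₁ y + W₂ z` of `ℝⁿ`. -/
noncomputable def pointOf {n k : ℕ} (hk : k < n) (W : Matrix (Fin n) (Fin n) ℝ)
    (y : EuclideanSpace ℝ (Fin k)) (z : EuclideanSpace ℝ (Fin (n - k))) :
    EuclideanSpace ℝ (Fin n) :=
  WithLp.toLp 2 (activeColumns hk W *ᵥ y.ofLp + inactiveColumns hk W *ᵥ z.ofLp)

/-- The joint density `ρ_{Y,Z}(y, z) = ρ(W₁ y + W₂ z)`. -/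
noncomputable def jointDensity {n k : ℕ} (hk : k < n) (W : Matrix (Fin n) (Fin n) ℝ)
    (ρ : EuclideanSpace ℝ (Fin n) → ℝ)
    (y : EuclideanSpace ℝ (Fin k)) (z : EuclideanSpace ℝ (Fin (n - k))) : ℝ :=
  ρ (pointOf hk W y z)

/-- The marginal density `ρ_Y(y) = ∫ ρ_{Y,Z}(y, z) dz`. -/
noncomputable def activeDensity {n k : ℕ} (hk : k < n) (W : Matrix (Fin n) (Fin n) ℝ)
    (ρ : EuclideanSpace ℝ (Fin n) → ℝ) (y : EuclideanSpace ℝ (Fin k)) : ℝ :=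
  ∫ z : EuclideanSpace ℝ (Fin (n - k)), jointDensity hk W ρ y z

/-- The conditional density `ρ_{Z|Y}(z | y) = ρ_{Y,Z}(y, z) / ρ_Y(y)`. It is `0` for every `z` when
`y` is outside of `W₁ᵀ 𝒳`, because the numerator vanishes. -/
noncomputable def condDensity {n k : ℕ} (hk : k < n) (W : Matrix (Fin n) (Fin n) ℝ)
    (ρ : EuclideanSpace ℝ (Fin n) → ℝ)
    (y : EuclideanSpace ℝ (Fin k)) (z : EuclideanSpace ℝ (Fin (n - k))) : ℝ :=
  jointDensity hk W ρ y z / activeDensity hk W ρ y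

/-- The conditional expectation `g(y) = ∫ f(W₁ y + W₂ z) ρ_{Z|Y}(z | y) dz`. -/
noncomputable def condMean {n k : ℕ} (hk : k < n) (W : Matrix (Fin n) (Fin n) ℝ)
    (ρ f : EuclideanSpace ℝ (Fin n) → ℝ) (y : EuclideanSpace ℝ (Fin k)) : ℝ :=
  ∫ z : EuclideanSpace ℝ (Fin (n - k)), f (pointOf hk W y z) * condDensity hk W ρ y z

/-- The ridge approximation `f_g(x) = g(W₁ᵀ x)`. -/
noncomputable def ridgeApprox {n k : ℕ} (hk : k < n) (W : Matrix (Fin n) (Fin n) ℝ)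
    (ρ f : EuclideanSpace ℝ (Fin n) → ℝ) (x : EuclideanSpace ℝ (Fin n)) : ℝ :=
  condMean hk W ρ f (activeVariable hk W x)

/-! The claim is a Poincaré inequality on each slice `{W₁ y + W₂ z}` in the variable `z`, with a
constant independent of `y`, `W` and `k`. Integrated over `y`, it bounds the error by a constant
times the mean of `‖W₂ᵀ ∇f‖²`. That mean is the trace of `W₂ᵀ C W₂`, where `C` is the gradient
matrix, hence the sum of the discarded eigenvalues.

The first obstacle is regularity. Partial derivatives at every point give neither differentiability
nor continuity, so there is no pointwise chain rule in a rotated direction. What survives is the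
fundamental theorem of calculus along almost every segment (`LineFTC`). In coordinate directions it
is the classical theorem, since on almost every line the derivative is integrable. To pass from
directions `u` and `v` to `u + v` (`LineFTC.add`), the segment is replaced by a staircase of `N`
small corners; the total error is governed by the `L¹` modulus of continuity of the gradient and
vanishes as `N → ∞`. Only local integrability of the gradient is needed, and this holds because `ρ`
is bounded below on compact subsets of its support.

The second ingredient is a Poincaré inequality with controlled constant
(`SegmentKernelBound.poincare`). The variance is at most the mean square difference at two
independent points `z` and `z + v`. That difference is an integral of the gradient over the joining
segment; a Cauchy–Schwarz inequality with weight `w s` and the substitution `p = z + s v` leave `‖h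
p‖²` against a kernel in `p`, and it remains to dominate this kernel by the density at `p`
(`SegmentKernelBound`). For uniform densities on convex sets, the endpoint farther from `p` is
integrated out at cost at most `2 ^ dim`. For Gaussian densities one completes the square, and the
weight `(s (1 - s)) ^ (-1/2)` tames a singularity of order `1 / (s (1 - s))`. Slices of a bounded
convex set are convex with no larger diameter, and Gaussian slices are standard Gaussian, so the
constant is uniform. -/

/-- Around two points of an open convex set, all nearby segments stay in a common compact
subset. -/
theorem exists_compact_segment_nhd {E : Type*} [NormedAddCommGroup E]
    [InnerProductSpace ℝ E] [FiniteDimensional ℝ E] {U : Set E} (hU : IsOpen U) (hc : Convex ℝ U) {x₀ w : E}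
    (h0 : x₀ ∈ U) (h1 : x₀ + w ∈ U) :
    ∃ δ : ℝ, 0 < δ ∧ ∃ K ⊆ U, IsCompact K ∧ ∀ x ∈ Metric.ball x₀ δ, ∀ s ∈ Set.Icc (0 : ℝ) 1,
      ∀ h : E, ‖h‖ ≤ δ → x + s • w + h ∈ K := by
  have hS : IsCompact ((fun s : ℝ => x₀ + s • w) '' Set.Icc 0 1) :=
    isCompact_Icc.image (by fun_prop)
  have hSU : ((fun s : ℝ => x₀ + s • w) '' Set.Icc 0 1) ⊆ U := by
    rintro _ ⟨s, hs, rfl⟩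
    exact hc.add_smul_mem h0 h1 hs
  obtain ⟨δ, hδ, hK⟩ := hS.exists_cthickening_subset_open hU hSU
  -- One half of the thickening radius pays for moving the base point, the other for `h`.
  refine ⟨δ / 2, by positivity, _, hK, hS.cthickening, fun x hx s hs h hh => ?_⟩
  refine Metric.mem_cthickening_of_dist_le _ _ δ _ ⟨s, hs, rfl⟩ ?_
  rw [dist_eq_norm]
  have : x + s • w + h - (x₀ + s • w) = (x - x₀) + h := by abel
  simp only [this]
  rw [Metric.mem_ball, dist_eq_norm] at hx
  linarith [norm_add_le (x - x₀) h]

/-! ### Fundamental theorem of calculus along almost every segment -/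

section WeakFTC

variable {E : Type*} [NormedAddCommGroup E] [InnerProductSpace ℝ E] [FiniteDimensional ℝ E]
  [MeasurableSpace E] [BorelSpace E]

/-- Translation is continuous in `L¹`. -/
theorem exists_lintegral_enorm_translate_sub_le {H : E → E} (hH : MemLp H 1 (volume : Measure E))
    {η : ENNReal} (hη : 0 < η) :
    ∃ δ : ℝ, 0 < δ ∧ ∀ h : E, ‖h‖ ≤ δ → ∫⁻ x, ‖H (h + x) - H x‖ₑ ≤ η := by
  have : Fact ((1 : ENNReal) ≠ ⊤) := ⟨ENNReal.one_ne_top⟩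
  have hc : Continuous fun h : E => (DomAddAct.mk h) +ᵥ hH.toLp H :=
    (continuous_id.vadd continuous_const).comp DomAddAct.continuous_mk
  have h0 := hc.tendsto 0
  rw [EMetric.tendsto_nhds] at h0
  obtain ⟨δ, hδ, hb⟩ := Metric.eventually_nhds_iff.1 (h0 η hη)
  refine ⟨δ / 2, by positivity, fun h hh => ?_⟩
  have h1 := hb (y := h) (by simpa using (by linarith : ‖h‖ < δ))
  rw [DomAddAct.mk_vadd_toLp, DomAddAct.mk_vadd_toLp, Lp.edist_toLp_toLp,
    eLpNorm_one_eq_lintegral_enorm] at h1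
  simpa using h1.le

/-- Almost every segment in a fixed direction sees an integrable function as integrable. -/
theorem ae_intervalIntegrable_line {H : E → E} (hm : Measurable H)
    (hH : Integrable H (volume : Measure E)) (w : E) :
    ∀ᵐ x : E, IntervalIntegrable (fun s : ℝ => H (x + s • w)) volume 0 1 := by
  have hmeas : Measurable fun p : ℝ × E => H (p.2 + p.1 • w) := by fun_prop
  have : Integrable (fun p : ℝ × E => H (p.2 + p.1 • w))
      ((volume.restrict (Set.Ioc (0 : ℝ) 1)).prod volume) := by
    rw [integrable_prod_iff hmeas.aestronglyMeasurable]
    refine ⟨Filter.Eventually.of_forall fun s => hH.comp_add_right (s • w), ?_⟩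
    have : ∀ s : ℝ, ∫ x, ‖H (x + s • w)‖ = ∫ x, ‖H x‖ := fun s =>
      integral_add_right_eq_self (fun x => ‖H x‖) (s • w)
    simp only [this]
    exact integrable_const _
  filter_upwards [this.prod_left_ae] with x hx
  rw [intervalIntegrable_iff_integrableOn_Ioc_of_le zero_le_one]
  exact hx

/-- The fundamental theorem of calculus for `F` with gradient field `G`, along almost every
translate of the segment `[0, u]` in `U`. -/
def LineFTC (U : Set E) (F : E → ℝ) (G : E → E) (u : E) : Prop :=
  ∀ᵐ x : E, x ∈ U → x + u ∈ U → F (x + u) - F x = ∫ s in (0 : ℝ)..1, inner ℝ (G (x + s • u)) u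

/-- Differentiability at every point of the line, together with integrability of the derivative on
almost every line (Fubini), is what the classical theorem needs. The exceptional set is shown null
near each of its points, where all segments stay in one compact `K` and `G` can be cut off to an
integrable field. -/
theorem lineFTC_of_hasDerivAt {U : Set E} (hU : IsOpen U) (hc : Convex ℝ U) {F : E → ℝ} {G : E → E}
    (hG : Measurable G) (hGi : LocallyIntegrableOn G U) (u : E)
    (hd : ∀ x ∈ U, HasDerivAt (fun t : ℝ => F (x + t • u)) (inner ℝ (G x) u) 0) :
    LineFTC U F G u := by
  rw [LineFTC, ae_iff]
  refine measure_null_of_locally_null _ fun x₀ hx₀ => ?_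
  simp only [Classical.not_imp, Set.mem_ofPred_eq] at hx₀
  obtain ⟨δ, hδ, K, hKU, hK, hseg⟩ := exists_compact_segment_nhd hU hc hx₀.1 hx₀.2.1
  refine ⟨_ ∩ Metric.ball x₀ δ, Filter.inter_mem self_mem_nhdsWithin
    (mem_nhdsWithin_of_mem_nhds (Metric.ball_mem_nhds x₀ hδ)), ?_⟩
  have hHi : Integrable (K.indicator G) :=
    (hGi.integrableOn_compact_subset hKU hK).integrable_indicator hK.measurableSet
  have hae := ae_intervalIntegrable_line (hG.indicator hK.measurableSet) hHi u
  rw [ae_iff] at hae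
  refine measure_mono_null ?_ hae
  rintro x ⟨hx, hxb⟩ hint
  simp only [Classical.not_imp, Set.mem_ofPred_eq] at hx
  apply hx.2.2
  have hmem : ∀ s ∈ Set.Icc (0 : ℝ) 1, x + s • u ∈ K := fun s hs => by
    simpa using hseg x hxb s hs 0 (by simpa using hδ.le)
  have h1 : IntervalIntegrable (fun s : ℝ => inner ℝ (G (x + s • u)) u) volume 0 1 := by
    have h2 : IntervalIntegrable (fun s : ℝ => inner ℝ (K.indicator G (x + s • u)) u)
        volume 0 1 := by
      rw [intervalIntegrable_iff_integrableOn_Ioc_of_le zero_le_one] at hint ⊢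
      exact hint.inner_const u
    refine h2.congr fun s hs => ?_
    rw [Set.uIoc_of_le zero_le_one] at hs
    simp only [Set.indicator_of_mem (hmem s ⟨hs.1.le, hs.2⟩)]
  rw [intervalIntegral.integral_eq_sub_of_hasDerivAt (f := fun s : ℝ => F (x + s • u)) _ h1]
  · simp
  · intro s hs
    rw [Set.uIcc_of_le zero_le_one] at hs
    have := hd _ (hKU (hmem s hs))
    have h3 : HasDerivAt (fun t : ℝ => F (x + s • u + (t - s) • u)) (inner ℝ (G (x + s • u)) u) s :=
      HasDerivAt.comp_sub_const s s (f := fun t : ℝ => F (x + s • u + t • u)) (by simpa using this)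
    have h4 : (fun t : ℝ => F (x + s • u + (t - s) • u)) = fun t : ℝ => F (x + t • u) := by
      funext t
      congr 1
      module
    rwa [h4] at h3

/-- One step of the staircase: the defect of the fundamental theorem of calculus in direction
`p + q` is controlled by the `L¹` modulus of continuity of the gradient. -/
theorem LineFTC.exists_defect_bound {U K : Set E} (hKU : K ⊆ U) (hK : MeasurableSet K) {F : E → ℝ}
    {G : E → E} (hG : Measurable G) (hGi : Integrable (K.indicator G)) {p q : E}
    (hp : LineFTC U F G p) (hq : LineFTC U F G q) {η : ENNReal}
    (hη : ∀ h : E, ‖h‖ ≤ ‖p‖ + ‖q‖ →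
      ∫⁻ x, ‖K.indicator G (h + x) - K.indicator G x‖ₑ ≤ η) :
    ∃ B : E → ENNReal, Measurable B ∧ ∫⁻ x, B x ≤ η * ‖p‖ₑ + η * ‖q‖ₑ ∧
      ∀ᵐ x : E, (∀ s ∈ Set.Icc (0 : ℝ) 1, x + s • p ∈ K ∧ x + p + s • q ∈ K) →
        ‖F (x + (p + q)) - F x -
          ∫ s in (0 : ℝ)..1, inner ℝ (K.indicator G (x + s • (p + q))) (p + q)‖ₑ ≤ B x := by
  set H := K.indicator G with hH
  have hHm : Measurable H := hG.indicator hK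
  -- Each leg of the corner is compared with the hypotenuse at the same parameter `s`. The two
  -- points differ by `s • q` on the first leg and by `(1 - s) • p` on the second, so the modulus of
  -- continuity applies to both.
  set B₁ : E → ENNReal := fun x =>
    ∫⁻ s in Set.Ioc (0 : ℝ) 1, ‖H (x + s • p) - H (x + s • (p + q))‖ₑ * ‖p‖ₑ
  set B₂ : E → ENNReal := fun x =>
    ∫⁻ s in Set.Ioc (0 : ℝ) 1, ‖H (x + p + s • q) - H (x + s • (p + q))‖ₑ * ‖q‖ₑ
  have hm₁ : Measurable (Function.uncurry fun (x : E) (s : ℝ) =>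
      ‖H (x + s • p) - H (x + s • (p + q))‖ₑ * ‖p‖ₑ) := by
    simp only [Function.uncurry_def]; fun_prop
  have hm₂ : Measurable (Function.uncurry fun (x : E) (s : ℝ) =>
      ‖H (x + p + s • q) - H (x + s • (p + q))‖ₑ * ‖q‖ₑ) := by
    simp only [Function.uncurry_def]; fun_prop
  have hB₁ : Measurable B₁ := hm₁.lintegral_prod_right
  have hB₂ : Measurable B₂ := hm₂.lintegral_prod_right
  have key : ∀ a b : E, ‖a - b‖ ≤ ‖p‖ + ‖q‖ → ∫⁻ x, ‖H (x + a) - H (x + b)‖ₑ ≤ η := by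
    intro a b hab
    refine le_trans (le_of_eq ?_) (hη (a - b) hab)
    rw [← lintegral_add_right_eq_self (fun x => ‖H (a - b + x) - H x‖ₑ) b]
    congr! 5 with x
    abel
  refine ⟨fun x => B₁ x + B₂ x, hB₁.add hB₂, ?_, ?_⟩
  · rw [lintegral_add_left hB₁]
    gcongr
    · rw [lintegral_lintegral_swap hm₁.aemeasurable]
      calc _ ≤ ∫⁻ s in Set.Ioc (0 : ℝ) 1, η * ‖p‖ₑ := by
            refine setLIntegral_mono measurable_const fun s hs => ?_
            rw [lintegral_mul_const _ (by fun_prop)]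
            gcongr
            refine key _ _ ?_
            have : s • p - s • (p + q) = -(s • q) := by module
            rw [this, norm_neg, norm_smul, Real.norm_of_nonneg hs.1.le]
            nlinarith [norm_nonneg p, norm_nonneg q, hs.2]
        _ = _ := by simp
    · rw [lintegral_lintegral_swap hm₂.aemeasurable]
      calc _ ≤ ∫⁻ s in Set.Ioc (0 : ℝ) 1, η * ‖q‖ₑ := by
            refine setLIntegral_mono measurable_const fun s hs => ?_
            rw [lintegral_mul_const _ (by fun_prop)]
            gcongr
            simp only [add_assoc]
            refine key _ _ ?_
            have : p + s • q - s • (p + q) = (1 - s) • p := by module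
            rw [this, norm_smul, Real.norm_of_nonneg (by linarith [hs.2])]
            nlinarith [norm_nonneg p, norm_nonneg q, hs.1]
        _ = _ := by simp
  · have hq' : ∀ᵐ x : E, x + p ∈ U → x + p + q ∈ U →
        F (x + p + q) - F (x + p) = ∫ s in (0 : ℝ)..1, inner ℝ (G (x + p + s • q)) q :=
      (measurePreserving_add_right volume p).quasiMeasurePreserving.ae hq
    have hi₂ : ∀ᵐ x : E, IntervalIntegrable (fun s : ℝ => H (x + p + s • q)) volume 0 1 :=
      (measurePreserving_add_right volume p).quasiMeasurePreserving.ae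
        (ae_intervalIntegrable_line hHm hGi q)
    filter_upwards [hp, hq', ae_intervalIntegrable_line hHm hGi p, hi₂,
      ae_intervalIntegrable_line hHm hGi (p + q)] with x h1 h2 i1 i2 i3 hx
    have m0 : x ∈ U := hKU (by simpa using (hx 0 (by simp)).1)
    have m1 : x + p ∈ U := hKU (by simpa using (hx 1 (by simp)).1)
    have m2 : x + p + q ∈ U := hKU (by simpa using (hx 1 (by simp)).2)
    have e1 : ∫ s in (0 : ℝ)..1, inner ℝ (G (x + s • p)) p
        = ∫ s in (0 : ℝ)..1, inner ℝ (H (x + s • p)) p := by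
      refine intervalIntegral.integral_congr fun s hs => ?_
      rw [Set.uIcc_of_le zero_le_one] at hs
      simp only [hH, Set.indicator_of_mem (hx s hs).1]
    have e2 : ∫ s in (0 : ℝ)..1, inner ℝ (G (x + p + s • q)) q
        = ∫ s in (0 : ℝ)..1, inner ℝ (H (x + p + s • q)) q := by
      refine intervalIntegral.integral_congr fun s hs => ?_
      rw [Set.uIcc_of_le zero_le_one] at hs
      simp only [hH, Set.indicator_of_mem (hx s hs).2]
    have ii : ∀ {φ : ℝ → E}, IntervalIntegrable φ volume 0 1 → ∀ v : E,
        IntervalIntegrable (fun s => inner ℝ (φ s) v) volume 0 1 := by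
      intro φ hφ v
      rw [intervalIntegrable_iff_integrableOn_Ioc_of_le zero_le_one] at hφ ⊢
      exact hφ.inner_const v
    have e3 : F (x + (p + q)) - F x - ∫ s in (0 : ℝ)..1, inner ℝ (H (x + s • (p + q))) (p + q)
        = (∫ s in (0 : ℝ)..1, inner ℝ (H (x + s • p) - H (x + s • (p + q))) p) +
          ∫ s in (0 : ℝ)..1, inner ℝ (H (x + p + s • q) - H (x + s • (p + q))) q := by
      simp only [inner_sub_left, inner_add_right]
      rw [intervalIntegral.integral_sub (ii i1 p) (ii i3 p),
        intervalIntegral.integral_sub (ii i2 q) (ii i3 q),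
        intervalIntegral.integral_add (ii i3 p) (ii i3 q), ← e1, ← e2, ← h1 m0 m1, ← h2 m1 m2,
        add_assoc]
      ring
    rw [e3]
    refine (enorm_add_le _ _).trans ?_
    have bd : ∀ (φ : ℝ → E) (v : E), ‖∫ s in (0 : ℝ)..1, inner ℝ (φ s) v‖ₑ
        ≤ ∫⁻ s in Set.Ioc (0 : ℝ) 1, ‖φ s‖ₑ * ‖v‖ₑ := by
      intro φ v
      rw [intervalIntegral.integral_of_le zero_le_one]
      refine (enorm_integral_le_lintegral_enorm _).trans (lintegral_mono fun s => ?_)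
      rw [← enorm_norm (φ s), ← enorm_norm v, ← enorm_mul]
      exact enorm_le_iff_norm_le.2 (by simpa using norm_inner_le_norm (𝕜 := ℝ) (φ s) v)
    exact add_le_add (bd _ _) (bd _ _)

/-- Staircase argument. Each of the `N` corners with legs `u / N`, `v / N` has defect at most `η
(‖u‖ + ‖v‖) / N` in `L¹`, where `η` bounds the `L¹` change of the gradient under short translations.
The sum is at most `η (‖u‖ + ‖v‖)`, and `η` is arbitrary. The legs shrink with `N`, hence the
assumption on all multiples of `u` and `v`. -/
theorem LineFTC.add {U : Set E} (hU : IsOpen U) (hc : Convex ℝ U) {F : E → ℝ} {G : E → E}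
    (hF : Measurable F) (hG : Measurable G) (hGi : LocallyIntegrableOn G U) {u v : E}
    (hu : ∀ t : ℝ, LineFTC U F G (t • u)) (hv : ∀ t : ℝ, LineFTC U F G (t • v)) :
    LineFTC U F G (u + v) := by
  rw [LineFTC, ae_iff]
  refine measure_null_of_locally_null _ fun x₀ hx₀ => ?_
  simp only [Classical.not_imp, Set.mem_ofPred_eq] at hx₀
  obtain ⟨δ, hδ, K, hKU, hK, hseg⟩ := exists_compact_segment_nhd hU hc hx₀.1 hx₀.2.1
  refine ⟨_ ∩ Metric.ball x₀ δ, Filter.inter_mem self_mem_nhdsWithin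
    (mem_nhdsWithin_of_mem_nhds (Metric.ball_mem_nhds x₀ hδ)), ?_⟩
  set w := u + v with hw
  set H := K.indicator G with hH
  have hHm : Measurable H := hG.indicator hK.measurableSet
  have hHi : Integrable H := (hGi.integrableOn_compact_subset hKU hK).integrable_indicator
    hK.measurableSet
  set c : E → ℝ := fun x => F (x + w) - F x - ∫ s in (0 : ℝ)..1, inner ℝ (H (x + s • w)) w with hcdef
  have hcm : Measurable c := by
    refine ((hF.comp (measurable_id.add_const w)).sub hF).sub ?_
    simp only [intervalIntegral.integral_of_le zero_le_one]
    have : StronglyMeasurable (Function.uncurry fun (x : E) (s : ℝ) =>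
        (inner ℝ (H (x + s • w)) w : ℝ)) := by
      apply Measurable.stronglyMeasurable
      simp only [Function.uncurry_def]
      fun_prop
    exact this.integral_prod_right.measurable
  have hbound : ∀ η : ENNReal, 0 < η →
      ∫⁻ x in Metric.ball x₀ δ, ‖c x‖ₑ ≤ η * (‖u‖ₑ + ‖v‖ₑ) := by
    intro η hη
    obtain ⟨δ', hδ', hmod⟩ :=
      exists_lintegral_enorm_translate_sub_le (memLp_one_iff_integrable.2 hHi) hη
    -- The corners must be shorter than `δ`, to stay in `K`, and than `δ'`, to use the modulus of
    -- continuity.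
    obtain ⟨N, hN⟩ := exists_nat_gt ((‖u‖ + ‖v‖) / min δ δ')
    have hmin : 0 < min δ δ' := lt_min hδ hδ'
    have hN0 : (0 : ℝ) < N := lt_of_le_of_lt (by positivity) hN
    have hNn : (N : ℝ) ≠ 0 := hN0.ne'
    have hlen : ‖(N : ℝ)⁻¹ • u‖ + ‖(N : ℝ)⁻¹ • v‖ ≤ min δ δ' := by
      rw [norm_smul, norm_smul, ← mul_add, norm_inv, Real.norm_of_nonneg hN0.le,
        inv_mul_le_iff₀ hN0]
      rw [div_lt_iff₀ hmin] at hN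
      exact hN.le
    obtain ⟨B, hBm, hBi, hB⟩ := LineFTC.exists_defect_bound hKU hK.measurableSet hG hHi
      (hu (N : ℝ)⁻¹) (hv (N : ℝ)⁻¹) (fun h hh => hmod h (hh.trans (hlen.trans (min_le_right _ _))))
    have hB' : ∀ᵐ x : E, ∀ j : ℕ, (∀ s ∈ Set.Icc (0 : ℝ) 1,
        x + ((j : ℝ) / N) • w + s • (N : ℝ)⁻¹ • u ∈ K ∧
        x + ((j : ℝ) / N) • w + (N : ℝ)⁻¹ • u + s • (N : ℝ)⁻¹ • v ∈ K) →
        ‖F (x + ((j : ℝ) / N) • w + ((N : ℝ)⁻¹ • u + (N : ℝ)⁻¹ • v)) - F (x + ((j : ℝ) / N) • w) -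
          ∫ s in (0 : ℝ)..1, inner ℝ (H (x + ((j : ℝ) / N) • w +
            s • ((N : ℝ)⁻¹ • u + (N : ℝ)⁻¹ • v))) ((N : ℝ)⁻¹ • u + (N : ℝ)⁻¹ • v)‖ₑ ≤
          B (x + ((j : ℝ) / N) • w) :=
      ae_all_iff.2 fun j =>
        (measurePreserving_add_right volume (((j : ℝ) / N) • w)).quasiMeasurePreserving.ae hB
    have hle : ∀ᵐ x ∂(volume.restrict (Metric.ball x₀ δ)),
        ‖c x‖ₑ ≤ ∑ j ∈ Finset.range N, B (x + ((j : ℝ) / N) • w) := by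
      rw [ae_restrict_iff' measurableSet_ball]
      filter_upwards [hB', ae_intervalIntegrable_line hHm hHi w] with x hx hint hxb
      have hstep : ∀ j ∈ Finset.range N,
          ‖(F (x + (((j + 1 : ℕ) : ℝ) / N) • w) - F (x + ((j : ℝ) / N) • w)) -
            ∫ s in ((j : ℝ) / N)..(((j + 1 : ℕ) : ℝ) / N), inner ℝ (H (x + s • w)) w‖ₑ ≤
          B (x + ((j : ℝ) / N) • w) := by
        intro j hj
        have hjN : (j : ℝ) + 1 ≤ N := by exact_mod_cast Finset.mem_range.1 hj
        have hj01 : (j : ℝ) / N ∈ Set.Icc (0 : ℝ) 1 :=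
          ⟨by positivity, (div_le_one hN0).2 (by linarith)⟩
        have h1 := hx j fun s hs => by
          have hsu : ‖s • (N : ℝ)⁻¹ • u‖ ≤ ‖(N : ℝ)⁻¹ • u‖ := by
            rw [norm_smul, Real.norm_of_nonneg hs.1]
            exact mul_le_of_le_one_left (norm_nonneg _) hs.2
          have hsv : ‖s • (N : ℝ)⁻¹ • v‖ ≤ ‖(N : ℝ)⁻¹ • v‖ := by
            rw [norm_smul, Real.norm_of_nonneg hs.1]
            exact mul_le_of_le_one_left (norm_nonneg _) hs.2
          have hm := min_le_left δ δ'
          refine ⟨hseg x hxb _ hj01 _ ?_, ?_⟩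
          · linarith [norm_nonneg ((N : ℝ)⁻¹ • v)]
          · rw [add_assoc]
            refine hseg x hxb _ hj01 _ ?_
            linarith [norm_add_le ((N : ℝ)⁻¹ • u) (s • (N : ℝ)⁻¹ • v)]
        rw [← smul_add, ← hw] at h1
        have e1 : x + (((j + 1 : ℕ) : ℝ) / N) • w = x + ((j : ℝ) / N) • w + (N : ℝ)⁻¹ • w := by
          rw [add_assoc, ← add_smul]
          congr 2
          push_cast
          field_simp
        have e2 : ∫ s in ((j : ℝ) / N)..(((j + 1 : ℕ) : ℝ) / N), inner ℝ (H (x + s • w)) w =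
            ∫ s in (0 : ℝ)..1,
              inner ℝ (H (x + ((j : ℝ) / N) • w + s • (N : ℝ)⁻¹ • w)) ((N : ℝ)⁻¹ • w) := by
          have := intervalIntegral.mul_integral_comp_mul_add
            (f := fun s : ℝ => (inner ℝ (H (x + s • w)) w : ℝ)) (a := 0) (b := 1)
            (c := (N : ℝ)⁻¹) (d := (j : ℝ) / N)
          have e3 : (N : ℝ)⁻¹ * 1 + j / N = ((j + 1 : ℕ) : ℝ) / N := by
            push_cast
            field_simp
            ring
          rw [mul_zero, zero_add, e3] at this
          rw [← this, ← intervalIntegral.integral_const_mul]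
          refine intervalIntegral.integral_congr fun s _ => ?_
          simp only [inner_smul_right]
          congr 3
          module
        rw [e1, e2]
        exact h1
      -- Both the increments of `F` and the integrals telescope along the subdivision `j / N`.
      have hsum : c x = ∑ j ∈ Finset.range N,
          ((F (x + (((j + 1 : ℕ) : ℝ) / N) • w) - F (x + ((j : ℝ) / N) • w)) -
            ∫ s in ((j : ℝ) / N)..(((j + 1 : ℕ) : ℝ) / N), inner ℝ (H (x + s • w)) w) := by
        rw [Finset.sum_sub_distrib,
          Finset.sum_range_sub (fun j : ℕ => F (x + ((j : ℝ) / N) • w)),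
          intervalIntegral.sum_integral_adjacent_intervals
            (a := fun j : ℕ => (j : ℝ) / N) (f := fun s => (inner ℝ (H (x + s • w)) w : ℝ))]
        · simp [hcdef, div_self hNn]
        · intro k hk
          have hkN : (k : ℝ) + 1 ≤ N := by exact_mod_cast hk
          have hI : IntervalIntegrable (fun s => (inner ℝ (H (x + s • w)) w : ℝ)) volume 0 1 := by
            rw [intervalIntegrable_iff_integrableOn_Ioc_of_le zero_le_one] at hint ⊢
            exact hint.inner_const w
          refine hI.mono_set ?_
          have hk1 : (k : ℝ) / N ≤ ((k + 1 : ℕ) : ℝ) / N := by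
            gcongr
            exact Nat.le_succ k
          rw [Set.uIcc_of_le zero_le_one, Set.uIcc_of_le hk1]
          refine Set.Icc_subset_Icc (by positivity) ((div_le_one hN0).2 ?_)
          push_cast
          exact hkN
      rw [hsum]
      exact (enorm_sum_le _ _).trans (Finset.sum_le_sum hstep)
    calc ∫⁻ x in Metric.ball x₀ δ, ‖c x‖ₑ
        ≤ ∫⁻ x in Metric.ball x₀ δ, ∑ j ∈ Finset.range N, B (x + ((j : ℝ) / N) • w) :=
          lintegral_mono_ae hle
      _ ≤ ∫⁻ x, ∑ j ∈ Finset.range N, B (x + ((j : ℝ) / N) • w) := setLIntegral_le_lintegral _ _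
      _ = N * ∫⁻ x, B x := by
          rw [lintegral_finsetSum _ fun j _ => by fun_prop]
          simp only [lintegral_add_right_eq_self]
          simp
      _ ≤ N * (η * ‖(N : ℝ)⁻¹ • u‖ₑ + η * ‖(N : ℝ)⁻¹ • v‖ₑ) := by gcongr
      _ = (N * ‖(N : ℝ)⁻¹‖ₑ) * (η * (‖u‖ₑ + ‖v‖ₑ)) := by
          rw [enorm_smul, enorm_smul]
          ring
      _ = η * (‖u‖ₑ + ‖v‖ₑ) := by
          have : (N : ENNReal) * ‖(N : ℝ)⁻¹‖ₑ = 1 := by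
            have h2 : (N : ENNReal) = ‖(N : ℝ)‖ₑ := by simp
            rw [h2, ← enorm_mul, mul_inv_cancel₀ hNn, enorm_one]
          rw [this, one_mul]
  have hzero : ∫⁻ x in Metric.ball x₀ δ, ‖c x‖ₑ = 0 := by
    have h3 : Filter.Tendsto (fun η : ENNReal => η * (‖u‖ₑ + ‖v‖ₑ)) (nhdsWithin 0 (Set.Ioi 0))
        (nhds 0) := by
      have := ENNReal.Tendsto.mul_const (b := ‖u‖ₑ + ‖v‖ₑ)
        (Filter.tendsto_id (α := ENNReal) (x := nhds 0)) (Or.inr (by simp))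
      rw [zero_mul] at this
      exact this.mono_left nhdsWithin_le_nhds
    exact le_antisymm (ge_of_tendsto h3 (Filter.eventually_of_mem self_mem_nhdsWithin hbound)) bot_le
  rw [lintegral_eq_zero_iff hcm.enorm, Filter.EventuallyEq, ae_restrict_iff' measurableSet_ball,
    ae_iff] at hzero
  refine measure_mono_null ?_ hzero
  rintro x ⟨hx, hxb⟩ hcx
  simp only [Classical.not_imp, Set.mem_ofPred_eq] at hx
  apply hx.2.2
  have h5 : c x = 0 := by simpa using hcx hxb
  have h6 : ∫ s in (0 : ℝ)..1, inner ℝ (G (x + s • w)) w =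
      ∫ s in (0 : ℝ)..1, inner ℝ (H (x + s • w)) w := by
    refine intervalIntegral.integral_congr fun s hs => ?_
    rw [Set.uIcc_of_le zero_le_one] at hs
    have : x + s • w ∈ K := by simpa using hseg x hxb s hs 0 (by simpa using hδ.le)
    simp only [hH, Set.indicator_of_mem this]
  rw [h6]
  exact sub_eq_zero.1 h5

/-- The fundamental theorem of calculus holds along almost every segment in every direction as
soon as it holds in the directions of a spanning set. -/
theorem lineFTC_of_span {U : Set E} (hU : IsOpen U) (hc : Convex ℝ U) {F : E → ℝ} {G : E → E}
    (hF : Measurable F) (hG : Measurable G) (hGi : LocallyIntegrableOn G U) {S : Set E}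
    (hS : Submodule.span ℝ S = ⊤) (h : ∀ e ∈ S, ∀ t : ℝ, LineFTC U F G (t • e)) (u : E) :
    LineFTC U F G u := by
  suffices ∀ t : ℝ, LineFTC U F G (t • u) by simpa using this 1
  have hu : u ∈ Submodule.span ℝ S := hS ▸ Submodule.mem_top
  induction hu using Submodule.span_induction with
  | mem e he => exact h e he
  | zero => intro t; simp [LineFTC]
  | add u v _ _ hu hv =>
    intro t
    rw [smul_add]
    refine LineFTC.add hU hc hF hG hGi (fun s => ?_) fun s => ?_
    · rw [smul_smul]; exact hu _
    · rw [smul_smul]; exact hv _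
  | smul a u _ hu => intro t; rw [smul_smul]; exact hu _

end WeakFTC

/-! ### Kernel bounds for uniform and Gaussian densities -/

section Poincare

/-- A weighted Cauchy–Schwarz inequality for the Lebesgue integral. -/
theorem sq_lintegral_le_lintegral_mul_lintegral {α : Type*} [MeasurableSpace α] {μ : Measure α}
    {a w : α → ENNReal} (ha : Measurable a) (hw : Measurable w)
    (h0 : ∀ᵐ s ∂μ, w s ≠ 0 ∧ w s ≠ ⊤) :
    (∫⁻ s, a s ∂μ) ^ 2 ≤ (∫⁻ s, w s ∂μ) * ∫⁻ s, (w s)⁻¹ * a s ^ 2 ∂μ := by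
  have h := ENNReal.lintegral_mul_le_Lp_mul_Lq μ Real.HolderConjugate.two_two
    (f := fun s => w s ^ (1 / 2 : ℝ)) (g := fun s => (w s ^ (1 / 2 : ℝ))⁻¹ * a s)
    (by fun_prop) (by fun_prop)
  have hsq : ∀ x : ENNReal, (x ^ (1 / 2 : ℝ)) ^ 2 = x := fun x => by
    rw [← ENNReal.rpow_natCast, ← ENNReal.rpow_mul]; norm_num
  have e1 : ∫⁻ s, ((fun s => w s ^ (1 / 2 : ℝ)) * fun s => (w s ^ (1 / 2 : ℝ))⁻¹ * a s) s ∂μ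
      = ∫⁻ s, a s ∂μ := by
    refine lintegral_congr_ae (h0.mono fun s hs => ?_)
    simp only [Pi.mul_apply]
    rw [← mul_assoc, ENNReal.mul_inv_cancel, one_mul]
    · simpa using hs.1
    · simpa using hs.2
  rw [e1] at h
  have h2 := pow_le_pow_left' h 2
  rw [mul_pow, hsq, hsq] at h2
  simp only [ENNReal.rpow_two, mul_pow, ← ENNReal.inv_pow, hsq] at h2
  exact h2

/-- Completing the square for two points of a Gaussian sample. -/
theorem exp_neg_sq_norm_pair_le {V : Type*} [NormedAddCommGroup V]
    [InnerProductSpace ℝ V] {s : ℝ} (hs : s ∈ Set.Ioo (0 : ℝ) 1) (p v : V) :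
    ‖v‖ ^ 2 * (Real.exp (-‖p - s • v‖ ^ 2 / 2) * Real.exp (-‖p + (1 - s) • v‖ ^ 2 / 2)) ≤
      64 / (s * (1 - s)) * (Real.exp (-‖p‖ ^ 2 / 2) *
        Real.exp (-(1 / 8) * ‖v + ((1 - 2 * s) / (1 - 2 * s + 2 * s ^ 2)) • p‖ ^ 2)) := by
  obtain ⟨h0, h1⟩ := hs
  set a := 1 - 2 * s + 2 * s ^ 2 with ha
  set m := (1 - 2 * s) / a with hm
  set t := s * (1 - s) with ht
  have ht0 : 0 < t := mul_pos h0 (by linarith)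
  have ha1 : 1 / 2 ≤ a := by nlinarith [sq_nonneg (1 - 2 * s)]
  have ha2 : a = 1 - 2 * t := by rw [ha, ht]; ring
  have ht4 : t ≤ 1 / 4 := by nlinarith [sq_nonneg (1 - 2 * s)]
  have ha0 : 0 < a := by linarith
  have hma : m * a = 1 - 2 * s := div_mul_cancel₀ _ ha0.ne'
  set X := ‖v + m • p‖ ^ 2 with hX
  set P := ‖p‖ ^ 2 with hP
  have hX0 : 0 ≤ X := by positivity
  have hP0 : 0 ≤ P := by positivity
  have i1 : ‖p - s • v‖ ^ 2 = P - 2 * s * inner ℝ p v + s ^ 2 * ‖v‖ ^ 2 := by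
    rw [norm_sub_sq_real, inner_smul_right, norm_smul, mul_pow, Real.norm_eq_abs, sq_abs]; ring
  have i2 : ‖p + (1 - s) • v‖ ^ 2 = P + 2 * (1 - s) * inner ℝ p v + (1 - s) ^ 2 * ‖v‖ ^ 2 := by
    rw [norm_add_sq_real, inner_smul_right, norm_smul, mul_pow, Real.norm_eq_abs, sq_abs]; ring
  have i3 : X = ‖v‖ ^ 2 + 2 * m * inner ℝ p v + m ^ 2 * P := by
    rw [hX, norm_add_sq_real, inner_smul_right, norm_smul, mul_pow, Real.norm_eq_abs, sq_abs,
      real_inner_comm]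
    ring
  have hsq : m ^ 2 * a ^ 2 = 1 - 4 * t := by rw [← mul_pow, hma, ht]; ring
  -- Here `a = s² + (1 - s)² = 1 - 2t`. Since `(1 + 2t)(1 - 2t) ≤ 1`, the term `P / a` exceeds `P`
  -- by at least `2tP`; this surplus is what absorbs the factor `P` hidden in `‖v‖²`.
  have hQ : ‖p - s • v‖ ^ 2 + ‖p + (1 - s) • v‖ ^ 2 = P / a + a * X := by
    rw [i1, i2, i3]
    have : a * (‖v‖ ^ 2 + 2 * m * inner ℝ p v + m ^ 2 * P) =
        a * ‖v‖ ^ 2 + 2 * (m * a) * inner ℝ p v + m ^ 2 * a ^ 2 * P / a := by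
      field_simp
    rw [this, hma, hsq]
    field_simp
    rw [ha2, ht]
    ring
  have hPa : P + 2 * t * P ≤ P / a := by
    rw [le_div_iff₀ ha0, ha2]
    nlinarith [mul_nonneg hP0 (mul_nonneg ht0.le ht0.le)]
  -- The Gaussian factor in `X` is split in two: one copy absorbs the polynomial factor `X + 1`, the
  -- other remains in the conclusion.
  have hexp : Real.exp (-‖p - s • v‖ ^ 2 / 2) * Real.exp (-‖p + (1 - s) • v‖ ^ 2 / 2) ≤
      Real.exp (-P / 2) * (Real.exp (-(X / 8)) * Real.exp (-(X / 8)) * Real.exp (-(t * P))) := by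
    rw [← Real.exp_add, ← Real.exp_add, ← Real.exp_add, ← Real.exp_add]
    refine Real.exp_le_exp.2 ?_
    have haX : 1 / 2 * X ≤ a * X := mul_le_mul_of_nonneg_right ha1 hX0
    linarith
  have hm4 : m ^ 2 ≤ 4 := by
    have : m ^ 2 * (1 / 4) ≤ m ^ 2 * a ^ 2 :=
      mul_le_mul_of_nonneg_left (by nlinarith) (sq_nonneg m)
    linarith
  have hv : ‖v‖ ^ 2 ≤ 2 * X + 8 * P := by
    have e : v = (v + m • p) - m • p := by abel
    have h3 : ‖v‖ ≤ ‖v + m • p‖ + ‖m • p‖ := by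
      conv_lhs => rw [e]
      exact norm_sub_le _ _
    have h4 : ‖m • p‖ ^ 2 = m ^ 2 * P := by
      rw [norm_smul, mul_pow, Real.norm_eq_abs, sq_abs]
    have h5 : ‖v‖ ^ 2 ≤ 2 * ‖v + m • p‖ ^ 2 + 2 * ‖m • p‖ ^ 2 := by
      have h6 := pow_le_pow_left₀ (norm_nonneg v) h3 2
      linarith [sq_nonneg (‖v + m • p‖ - ‖m • p‖),
        (by ring : (‖v + m • p‖ + ‖m • p‖) ^ 2 + (‖v + m • p‖ - ‖m • p‖) ^ 2 =
          2 * ‖v + m • p‖ ^ 2 + 2 * ‖m • p‖ ^ 2)]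
    rw [h4] at h5
    linarith [mul_le_mul_of_nonneg_right hm4 hP0]
  have hP1 : P * Real.exp (-(t * P)) ≤ 1 / t := by
    rw [Real.exp_neg, ← div_eq_mul_inv, div_le_div_iff₀ (Real.exp_pos _) ht0]
    linarith [Real.add_one_le_exp (t * P)]
  have hX1 : (X + 1) * Real.exp (-(X / 8)) ≤ 8 := by
    rw [Real.exp_neg, ← div_eq_mul_inv, div_le_iff₀ (Real.exp_pos _)]
    linarith [Real.add_one_le_exp (X / 8)]
  have hE1 : Real.exp (-(t * P)) ≤ 1 := Real.exp_le_one_iff.2 (by nlinarith)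
  have h1t : 1 ≤ 1 / t := by rw [le_div_iff₀ ht0]; linarith
  calc ‖v‖ ^ 2 * (Real.exp (-‖p - s • v‖ ^ 2 / 2) * Real.exp (-‖p + (1 - s) • v‖ ^ 2 / 2))
      ≤ (2 * X + 8 * P) * (Real.exp (-P / 2) *
        (Real.exp (-(X / 8)) * Real.exp (-(X / 8)) * Real.exp (-(t * P)))) := by gcongr
    _ = Real.exp (-P / 2) * Real.exp (-(X / 8)) * (Real.exp (-(X / 8)) *
        (2 * X * Real.exp (-(t * P)) + 8 * (P * Real.exp (-(t * P))))) := by ring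
    _ ≤ Real.exp (-P / 2) * Real.exp (-(X / 8)) * (Real.exp (-(X / 8)) *
        (8 * X * (1 / t) + 8 * (1 / t))) := by
        have : 2 * X * Real.exp (-(t * P)) ≤ 8 * X * (1 / t) := by
          refine mul_le_mul (by linarith) (hE1.trans h1t) (Real.exp_pos _).le (by linarith)
        gcongr
    _ = Real.exp (-P / 2) * Real.exp (-(X / 8)) * (8 * (1 / t) *
        ((X + 1) * Real.exp (-(X / 8)))) := by ring
    _ ≤ Real.exp (-P / 2) * Real.exp (-(X / 8)) * (8 * (1 / t) * 8) := by gcongr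
    _ = 64 / t * (Real.exp (-P / 2) * Real.exp (-(1 / 8) * X)) := by
        rw [show -(X / 8) = -(1 / 8) * X by ring]
        ring

variable {V : Type*} [NormedAddCommGroup V] [InnerProductSpace ℝ V] [FiniteDimensional ℝ V]
  [MeasurableSpace V] [BorelSpace V]

/-- The kernel of pairs of points drawn from `r`, seen from the points of the segment between them,
is dominated by `r`. Here `w` is a weight for the position on the segment. -/
def SegmentKernelBound (r : V → ENNReal) (w : ℝ → ENNReal) (C : ENNReal) : Prop :=
  ∀ p : V, ∫⁻ s in Set.Ioo (0 : ℝ) 1, ∫⁻ v : V,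
    (w s)⁻¹ * ‖v‖ₑ ^ 2 * (r (p - s • v) * r (p + (1 - s) • v)) ≤ C * r p

/-- Tonelli and the translation `p = z + s v` at fixed `s` and `v`: the endpoints `z` and `z + v`
become `p - s v` and `p + (1 - s) v`. -/
theorem lintegral_segment_change_of_variables {r h : V → ENNReal} {w : ℝ → ENNReal}
    (hr : Measurable r) (hh : Measurable h) (hw : Measurable w) :
    ∫⁻ z, ∫⁻ v, ∫⁻ s in Set.Ioo (0 : ℝ) 1,
        (w s)⁻¹ * (‖v‖ₑ * h (z + s • v)) ^ 2 * (r z * r (z + v)) =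
      ∫⁻ p, ∫⁻ s in Set.Ioo (0 : ℝ) 1, ∫⁻ v, h p ^ 2 * ((w s)⁻¹ * ‖v‖ₑ ^ 2 *
        (r (p - s • v) * r (p + (1 - s) • v))) := by
  calc _ = ∫⁻ z, ∫⁻ s in Set.Ioo (0 : ℝ) 1, ∫⁻ v,
        (w s)⁻¹ * (‖v‖ₑ * h (z + s • v)) ^ 2 * (r z * r (z + v)) := by
        refine lintegral_congr fun z => lintegral_lintegral_swap ?_
        simp only [Function.uncurry_def]
        fun_prop
  _ = ∫⁻ s in Set.Ioo (0 : ℝ) 1, ∫⁻ z, ∫⁻ v,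
        (w s)⁻¹ * (‖v‖ₑ * h (z + s • v)) ^ 2 * (r z * r (z + v)) := by
        refine lintegral_lintegral_swap (Measurable.aemeasurable ?_)
        have : Measurable fun q : (V × ℝ) × V =>
          (w q.1.2)⁻¹ * (‖q.2‖ₑ * h (q.1.1 + q.1.2 • q.2)) ^ 2 * (r q.1.1 * r (q.1.1 + q.2)) := by
          fun_prop
        exact this.lintegral_prod_right'
  _ = ∫⁻ s in Set.Ioo (0 : ℝ) 1, ∫⁻ v, ∫⁻ z,
        (w s)⁻¹ * (‖v‖ₑ * h (z + s • v)) ^ 2 * (r z * r (z + v)) := by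
        refine lintegral_congr fun s => lintegral_lintegral_swap ?_
        simp only [Function.uncurry_def]
        fun_prop
  _ = ∫⁻ s in Set.Ioo (0 : ℝ) 1, ∫⁻ v, ∫⁻ p, h p ^ 2 * ((w s)⁻¹ * ‖v‖ₑ ^ 2 *
        (r (p - s • v) * r (p + (1 - s) • v))) := by
        refine lintegral_congr fun s => lintegral_congr fun v => ?_
        conv_rhs => rw [← lintegral_add_right_eq_self _ (s • v)]
        refine lintegral_congr fun z => ?_
        have e1 : z + s • v - s • v = z := by abel
        have e2 : z + s • v + (1 - s) • v = z + v := by module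
        rw [e1, e2]
        ring
  _ = ∫⁻ s in Set.Ioo (0 : ℝ) 1, ∫⁻ p, ∫⁻ v, h p ^ 2 * ((w s)⁻¹ * ‖v‖ₑ ^ 2 *
        (r (p - s • v) * r (p + (1 - s) • v))) := by
        refine lintegral_congr fun s => lintegral_lintegral_swap ?_
        simp only [Function.uncurry_def]
        fun_prop
  _ = ∫⁻ p, ∫⁻ s in Set.Ioo (0 : ℝ) 1, ∫⁻ v, h p ^ 2 * ((w s)⁻¹ * ‖v‖ₑ ^ 2 *
        (r (p - s • v) * r (p + (1 - s) • v))) := by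
        refine lintegral_lintegral_swap (Measurable.aemeasurable ?_)
        have : Measurable fun q : (ℝ × V) × V =>
          h q.1.2 ^ 2 * ((w q.1.1)⁻¹ * ‖q.2‖ₑ ^ 2 *
            (r (q.1.2 - q.1.1 • q.2) * r (q.1.2 + (1 - q.1.1) • q.2))) := by
          fun_prop
        exact this.lintegral_prod_right'

-- Cauchy–Schwarz in `s` with weight `w` costs the factor `∫ w` and leaves `(w s)⁻¹` under the
-- integral. After the change of variables the inner integral is exactly the one that the kernel
-- bound controls.
set_option maxHeartbeats 1000000 in
theorem SegmentKernelBound.lintegral_pair_le {r h : V → ENNReal} {w : ℝ → ENNReal} {C : ENNReal}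
    (hr : Measurable r) (hh : Measurable h) (hw : Measurable w)
    (h0 : ∀ s ∈ Set.Ioo (0 : ℝ) 1, w s ≠ 0 ∧ w s ≠ ⊤)
    (hker : SegmentKernelBound r w C) {D : V → V → ENNReal}
    (hD : ∀ᵐ z, ∀ᵐ v, r z * r (z + v) ≠ 0 →
      D z v ≤ ∫⁻ s in Set.Ioo (0 : ℝ) 1, ‖v‖ₑ * h (z + s • v)) :
    ∫⁻ z, ∫⁻ v, D z v ^ 2 * (r z * r (z + v)) ≤
      (∫⁻ s in Set.Ioo (0 : ℝ) 1, w s) * C * ∫⁻ p, h p ^ 2 * r p := by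
  obtain ⟨κ, hκ⟩ : ∃ κ, κ = ∫⁻ s in Set.Ioo (0 : ℝ) 1, w s := ⟨_, rfl⟩
  rw [← hκ]
  have step1 : ∫⁻ z, ∫⁻ v, D z v ^ 2 * (r z * r (z + v)) ≤
      ∫⁻ z, ∫⁻ v, κ * ∫⁻ s in Set.Ioo (0 : ℝ) 1,
        (w s)⁻¹ * (‖v‖ₑ * h (z + s • v)) ^ 2 * (r z * r (z + v)) := by
    refine lintegral_mono_ae (hD.mono fun z hz => lintegral_mono_ae (hz.mono fun v hv => ?_))
    by_cases hrr : r z * r (z + v) = 0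
    · simp [hrr]
    rw [lintegral_mul_const _ (by fun_prop), ← mul_assoc κ]
    refine mul_le_mul_left ?_ _
    rw [hκ]
    refine (pow_le_pow_left' (hv hrr) 2).trans ?_
    refine sq_lintegral_le_lintegral_mul_lintegral (by fun_prop) hw ?_
    rw [ae_restrict_iff' measurableSet_Ioo]
    exact Filter.Eventually.of_forall h0
  refine step1.trans ?_
  have m1 : Measurable fun q : (V × V) × ℝ =>
      (w q.2)⁻¹ * (‖q.1.2‖ₑ * h (q.1.1 + q.2 • q.1.2)) ^ 2 * (r q.1.1 * r (q.1.1 + q.1.2)) := by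
    fun_prop
  calc ∫⁻ z, ∫⁻ v, κ * ∫⁻ s in Set.Ioo (0 : ℝ) 1,
        (w s)⁻¹ * (‖v‖ₑ * h (z + s • v)) ^ 2 * (r z * r (z + v))
      = κ * ∫⁻ z, ∫⁻ v, ∫⁻ s in Set.Ioo (0 : ℝ) 1,
        (w s)⁻¹ * (‖v‖ₑ * h (z + s • v)) ^ 2 * (r z * r (z + v)) := by
        have : Measurable fun q : V × V => ∫⁻ s in Set.Ioo (0 : ℝ) 1,
          (w s)⁻¹ * (‖q.2‖ₑ * h (q.1 + s • q.2)) ^ 2 * (r q.1 * r (q.1 + q.2)) :=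
          m1.lintegral_prod_right'
        rw [← lintegral_const_mul _ this.lintegral_prod_right']
        refine lintegral_congr fun z => ?_
        exact lintegral_const_mul κ (this.comp measurable_prodMk_left)
    _ = κ * ∫⁻ p, ∫⁻ s in Set.Ioo (0 : ℝ) 1, ∫⁻ v, h p ^ 2 * ((w s)⁻¹ * ‖v‖ₑ ^ 2 *
        (r (p - s • v) * r (p + (1 - s) • v))) := by
        rw [lintegral_segment_change_of_variables hr hh hw]
    _ ≤ κ * ∫⁻ p, C * (h p ^ 2 * r p) := by
        gcongr with p
        have m3 : Measurable fun q : ℝ × V => (w q.1)⁻¹ * ‖q.2‖ₑ ^ 2 *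
            (r (p - q.1 • q.2) * r (p + (1 - q.1) • q.2)) := by fun_prop
        have : ∀ s, ∫⁻ v, h p ^ 2 * ((w s)⁻¹ * ‖v‖ₑ ^ 2 *
            (r (p - s • v) * r (p + (1 - s) • v))) = h p ^ 2 * ∫⁻ v, ((w s)⁻¹ * ‖v‖ₑ ^ 2 *
            (r (p - s • v) * r (p + (1 - s) • v))) := fun s =>
          lintegral_const_mul _ (m3.comp measurable_prodMk_left)
        simp only [this]
        rw [lintegral_const_mul _ m3.lintegral_prod_right']
        calc _ ≤ h p ^ 2 * (C * r p) := by gcongr; exact hker p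
          _ = _ := by ring
    _ = κ * C * ∫⁻ p, h p ^ 2 * r p := by
        rw [lintegral_const_mul _ (by fun_prop), mul_assoc]

theorem lintegral_add_smul_eq (r : V → ENNReal) (hr : Measurable r) (p : V) {c : ℝ} (hc : c ≠ 0) :
    ∫⁻ v, r (p + c • v) =
      ENNReal.ofReal |(c ^ Module.finrank ℝ V)⁻¹| * ∫⁻ v, r v := by
  rw [← lintegral_map (f := fun v => r (p + v)) (g := fun v : V => c • v) (by fun_prop)
    (by fun_prop), Measure.map_addHaar_smul volume hc, lintegral_smul_measure,
    lintegral_add_left_eq_self]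
  rfl

/-- Uniform densities on bounded convex sets satisfy the kernel bound. -/
theorem segmentKernelBound_of_convex {K : Set V} (hK : Convex ℝ K) (hKm : MeasurableSet K) {d : ℝ}
    (hd : ∀ x ∈ K, ∀ y ∈ K, ‖x - y‖ ≤ d) {c : ENNReal}
    (hr : ∫⁻ v, K.indicator (fun _ => c) v ≤ 1) :
    SegmentKernelBound (K.indicator fun _ => c) (fun _ => 1)
      (ENNReal.ofReal d ^ 2 * 2 ^ Module.finrank ℝ V) := by
  intro p
  set r : V → ENNReal := K.indicator fun _ => c with hrdef
  have hrm : Measurable r := measurable_const.indicator hKm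
  -- If both endpoints lie in `K`, so does `p` by convexity, and the density takes the same value at
  -- all three points. Hence either endpoint's factor may be traded for `r p`.
  have hpt : ∀ s ∈ Set.Ioo (0 : ℝ) 1, ∀ v : V, ‖v‖ₑ ^ 2 * (r (p - s • v) * r (p + (1 - s) • v)) ≤
      ENNReal.ofReal d ^ 2 * r p * r (p + (-s) • v) ∧
      ‖v‖ₑ ^ 2 * (r (p - s • v) * r (p + (1 - s) • v)) ≤
      ENNReal.ofReal d ^ 2 * r p * r (p + (1 - s) • v) := by
    intro s hs v
    by_cases h1 : p - s • v ∈ K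
    · by_cases h2 : p + (1 - s) • v ∈ K
      · have h3 : p ∈ K := by
          have := hK h1 h2 (a := 1 - s) (b := s) (by linarith [hs.2]) hs.1.le (by ring)
          convert this using 1
          module
        have hv : ‖v‖ₑ ≤ ENNReal.ofReal d := by
          have := hd _ h2 _ h1
          have e : p + (1 - s) • v - (p - s • v) = v := by module
          rw [e] at this
          rw [← ofReal_norm]
          exact ENNReal.ofReal_le_ofReal this
        have h1' : p + (-s) • v ∈ K := by rwa [neg_smul, ← sub_eq_add_neg]
        simp only [hrdef, Set.indicator_of_mem h1, Set.indicator_of_mem h2,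
          Set.indicator_of_mem h3, Set.indicator_of_mem h1']
        rw [mul_assoc]
        constructor <;> gcongr
      · simp [hrdef, h2]
    · simp [hrdef, h1]
  have hin : ∀ s ∈ Set.Ioo (0 : ℝ) 1, ∫⁻ v : V,
      (1 : ENNReal)⁻¹ * ‖v‖ₑ ^ 2 * (r (p - s • v) * r (p + (1 - s) • v)) ≤
      ENNReal.ofReal d ^ 2 * 2 ^ Module.finrank ℝ V * r p := by
    intro s hs
    have hgen : ∀ c : ℝ, (1 / 2 : ℝ) ≤ |c| → ∫⁻ v, ENNReal.ofReal d ^ 2 * r p * r (p + c • v) ≤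
        ENNReal.ofReal d ^ 2 * 2 ^ Module.finrank ℝ V * r p := by
      intro c hc
      have hc0 : c ≠ 0 := by
        rintro rfl
        norm_num at hc
      rw [lintegral_const_mul _ (by fun_prop), lintegral_add_smul_eq r hrm p hc0]
      have h2 : ENNReal.ofReal |(c ^ Module.finrank ℝ V)⁻¹| ≤ 2 ^ Module.finrank ℝ V := by
        have : (2 : ENNReal) ^ Module.finrank ℝ V = ENNReal.ofReal (2 ^ Module.finrank ℝ V) := by
          rw [ENNReal.ofReal_pow (by norm_num)]
          simp
        rw [this]
        refine ENNReal.ofReal_le_ofReal ?_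
        rw [abs_inv, abs_pow, ← inv_pow]
        refine pow_le_pow_left₀ (by positivity) ?_ _
        exact inv_le_of_inv_le₀ (by norm_num) (by linarith)
      calc ENNReal.ofReal d ^ 2 * r p * (ENNReal.ofReal |(c ^ Module.finrank ℝ V)⁻¹| * ∫⁻ v, r v)
          ≤ ENNReal.ofReal d ^ 2 * r p * (2 ^ Module.finrank ℝ V * 1) := by gcongr
        _ = _ := by ring
    -- Keep the endpoint whose coefficient has absolute value at least `1 / 2`, so that the Jacobian
    -- stays below `2 ^ dim`.
    rcases le_total s (1 / 2) with h | h
    · refine le_trans (lintegral_mono fun v => ?_) (hgen (1 - s) ?_)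
      · simpa using (hpt s hs v).2
      · rw [abs_of_nonneg] <;> linarith
    · refine le_trans (lintegral_mono fun v => ?_) (hgen (-s) ?_)
      · simpa using (hpt s hs v).1
      · rw [abs_neg, abs_of_nonneg] <;> linarith
  calc _ ≤ ∫⁻ s in Set.Ioo (0 : ℝ) 1, ENNReal.ofReal d ^ 2 * 2 ^ Module.finrank ℝ V * r p :=
        setLIntegral_mono measurable_const hin
    _ = _ := by simp

/-- The weight used for Gaussian densities. -/
noncomputable def gaussianWeight (s : ℝ) : ENNReal :=
  ENNReal.ofReal ((s * (1 - s)) ^ (-(1 / 2) : ℝ))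

theorem measurable_gaussianWeight : Measurable gaussianWeight := by
  unfold gaussianWeight
  fun_prop

theorem gaussianWeight_ne_zero {s : ℝ} (hs : s ∈ Set.Ioo (0 : ℝ) 1) : gaussianWeight s ≠ 0 := by
  have : 0 < s * (1 - s) := mul_pos hs.1 (by linarith [hs.2])
  simpa [gaussianWeight] using Real.rpow_pos_of_pos this _

/-- On each half of the interval one of the factors `s ^ (-1/2)`, `(1 - s) ^ (-1/2)` is at most `2`,
so the weight is dominated by twice their sum. -/
theorem lintegral_gaussianWeight_lt_top :
    ∫⁻ s in Set.Ioo (0 : ℝ) 1, gaussianWeight s < ⊤ := by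
  have h1 : IntervalIntegrable (fun s : ℝ => s ^ (-(1 / 2) : ℝ)) volume 0 1 :=
    intervalIntegral.intervalIntegrable_rpow' (by norm_num)
  have h2 : IntervalIntegrable (fun s : ℝ => (1 - s) ^ (-(1 / 2) : ℝ)) volume 0 1 := by
    have := h1.comp_sub_left 1
    simpa using this.symm
  have h3 := ((h1.add h2).const_mul 2)
  rw [intervalIntegrable_iff_integrableOn_Ioo_of_le zero_le_one] at h3
  refine lt_of_le_of_lt (setLIntegral_mono' measurableSet_Ioo fun s hs => ?_) h3.2
  have hs1 : 0 < 1 - s := by linarith [hs.2]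
  rw [gaussianWeight, ← ofReal_norm]
  refine ENNReal.ofReal_le_ofReal (le_trans ?_ (le_abs_self _))
  rw [Real.mul_rpow hs.1.le hs1.le]
  have ha : 0 < s ^ (-(1 / 2) : ℝ) := Real.rpow_pos_of_pos hs.1 _
  have hb : 0 < (1 - s) ^ (-(1 / 2) : ℝ) := Real.rpow_pos_of_pos hs1 _
  have key : ∀ x : ℝ, 1 / 2 ≤ x → x ^ (-(1 / 2) : ℝ) ≤ 2 := by
    intro x hx
    calc x ^ (-(1 / 2) : ℝ) ≤ (1 / 2 : ℝ) ^ (-(1 / 2) : ℝ) :=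
          Real.rpow_le_rpow_of_nonpos (by norm_num) hx (by norm_num)
      _ ≤ (1 / 2 : ℝ) ^ (-1 : ℝ) :=
          Real.rpow_le_rpow_of_exponent_ge (by norm_num) (by norm_num) (by norm_num)
      _ = 2 := by rw [Real.rpow_neg_one]; norm_num
  rcases le_total s (1 / 2) with h | h
  · nlinarith [key (1 - s) (by linarith)]
  · nlinarith [key s h]

/-- Gaussian densities satisfy the kernel bound. -/
theorem segmentKernelBound_gaussian {c : ℝ} (hc : 0 ≤ c) :
    SegmentKernelBound (fun z : V => ENNReal.ofReal (c * Real.exp (-‖z‖ ^ 2 / 2))) gaussianWeight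
      (ENNReal.ofReal (64 * c) * (∫⁻ v : V, ENNReal.ofReal (Real.exp (-(1 / 8) * ‖v‖ ^ 2))) *
        ∫⁻ s in Set.Ioo (0 : ℝ) 1, gaussianWeight s) := by
  intro p
  set J := ∫⁻ v : V, ENNReal.ofReal (Real.exp (-(1 / 8) * ‖v‖ ^ 2))
  set A := ENNReal.ofReal (64 * c) * ENNReal.ofReal (c * Real.exp (-‖p‖ ^ 2 / 2))
  have hin : ∀ s ∈ Set.Ioo (0 : ℝ) 1, ∫⁻ v : V, (gaussianWeight s)⁻¹ * ‖v‖ₑ ^ 2 *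
      (ENNReal.ofReal (c * Real.exp (-‖p - s • v‖ ^ 2 / 2)) *
        ENNReal.ofReal (c * Real.exp (-‖p + (1 - s) • v‖ ^ 2 / 2))) ≤
      A * J * gaussianWeight s := by
    intro s hs
    have ht : 0 < s * (1 - s) := mul_pos hs.1 (by linarith [hs.2])
    have hw : 0 < (s * (1 - s)) ^ (-(1 / 2) : ℝ) := Real.rpow_pos_of_pos ht _
    have hww : ((s * (1 - s)) ^ (-(1 / 2) : ℝ)) * ((s * (1 - s)) ^ (-(1 / 2) : ℝ)) =
        1 / (s * (1 - s)) := by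
      rw [← Real.rpow_add ht]
      norm_num [Real.rpow_neg_one]
    set W := (s * (1 - s)) ^ (-(1 / 2) : ℝ) with hWdef
    obtain ⟨m, hm⟩ : ∃ m, m = (1 - 2 * s) / (1 - 2 * s + 2 * s ^ 2) := ⟨_, rfl⟩
    calc _ ≤ ∫⁻ v : V, A * gaussianWeight s *
          ENNReal.ofReal (Real.exp (-(1 / 8) * ‖v + m • p‖ ^ 2)) := by
          refine lintegral_mono fun v => ?_
          simp only [A]
          rw [gaussianWeight, ← hWdef, ← ENNReal.ofReal_inv_of_pos hw, ← ofReal_norm,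
            ← ENNReal.ofReal_pow (norm_nonneg _), ← ENNReal.ofReal_mul (by positivity),
            ← ENNReal.ofReal_mul (by positivity), ← ENNReal.ofReal_mul (by positivity),
            ← ENNReal.ofReal_mul (by positivity), ← ENNReal.ofReal_mul (by positivity),
            ← ENNReal.ofReal_mul (by positivity)]
          refine ENNReal.ofReal_le_ofReal ?_
          have h := exp_neg_sq_norm_pair_le hs p v
          rw [← hm] at h
          have h' := mul_le_mul_of_nonneg_left h (by positivity : 0 ≤ W⁻¹ * (c * c))
          refine le_trans (le_of_eq (by ring)) (h'.trans (le_of_eq ?_))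
          -- The exponent `-1/2` balances the two requirements: `W⁻¹ / (s (1 - s)) = W`, so the
          -- weight and the weighted kernel have the same integrable singularity.
          have : 64 / (s * (1 - s)) = 64 * (W * W) := by rw [hww]; ring
          rw [this]
          field_simp
      _ = A * gaussianWeight s * J := by
          rw [lintegral_const_mul _ (by fun_prop),
            lintegral_add_right_eq_self
              (fun v : V => ENNReal.ofReal (Real.exp (-(1 / 8) * ‖v‖ ^ 2)))]
      _ = _ := by ring
  calc _ ≤ ∫⁻ s in Set.Ioo (0 : ℝ) 1, A * J * gaussianWeight s :=
        setLIntegral_mono (measurable_gaussianWeight.const_mul _) hin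
    _ = A * J * ∫⁻ s in Set.Ioo (0 : ℝ) 1, gaussianWeight s :=
        lintegral_const_mul _ measurable_gaussianWeight
    _ = _ := by ring

theorem lintegral_exp_neg_mul_sq_norm_lt_top {b : ℝ} (hb : 0 < b) :
    ∫⁻ v : V, ENNReal.ofReal (Real.exp (-b * ‖v‖ ^ 2)) < ⊤ := by
  have h : Integrable fun v : V => Real.exp (-b * ‖v‖ ^ 2) := by
    -- A non-integrable function would have Bochner integral `0`, against the positive closed form.
    refine not_not.1 fun hn => ?_
    have h1 := GaussianFourier.integral_rexp_neg_mul_sq_norm (V := V) hb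
    rw [integral_undef hn] at h1
    have : 0 < (Real.pi / b) ^ (Module.finrank ℝ V / 2 : ℝ) :=
      Real.rpow_pos_of_pos (by positivity) _
    linarith
  exact h.lintegral_lt_top

end Poincare

/-! ### From mean square differences to the variance -/

section Variance

/-- The variance is bounded by the mean square difference of two independent samples. -/
theorem integrable_and_lintegral_sub_integral_sq_le {V : Type*} [MeasurableSpace V]
    {π : Measure V} [IsProbabilityMeasure π] {φ : V → ℝ} (hφ : Measurable φ) {I : ENNReal}
    (hI : ∫⁻ z, ∫⁻ z', ‖φ z' - φ z‖ₑ ^ 2 ∂π ∂π ≤ I) (hI' : I ≠ ⊤) :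
    Integrable φ π ∧ ∫⁻ z, ‖φ z - ∫ z', φ z' ∂π‖ₑ ^ 2 ∂π ≤ I := by
  have hm : Measurable fun z => ∫⁻ z', ‖φ z' - φ z‖ₑ ^ 2 ∂π := by
    have : Measurable fun q : V × V => ‖φ q.2 - φ q.1‖ₑ ^ 2 := by fun_prop
    exact this.lintegral_prod_right'
  have hcs : ∀ z, (∫⁻ z', ‖φ z' - φ z‖ₑ ∂π) ^ 2 ≤ ∫⁻ z', ‖φ z' - φ z‖ₑ ^ 2 ∂π := fun z => by
    have := sq_lintegral_le_lintegral_mul_lintegral (μ := π) (a := fun z' => ‖φ z' - φ z‖ₑ)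
      (w := fun _ => 1) (by fun_prop) measurable_const (by simp)
    simpa using this
  have hfin : ∀ᵐ z ∂π, ∫⁻ z', ‖φ z' - φ z‖ₑ ^ 2 ∂π < ⊤ :=
    ae_lt_top hm (ne_top_of_le_ne_top hI' hI)
  -- Integrability of `φ` is not assumed; it follows from that of `φ - φ z₀` for a single good base
  -- point.
  obtain ⟨z₀, hz₀⟩ := hfin.exists
  have hint : Integrable φ π := by
    have h1 : Integrable (fun z' => φ z' - φ z₀) π := by
      refine ⟨(hφ.sub_const _).aestronglyMeasurable, ?_⟩
      have := (hcs z₀).trans_lt hz₀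
      exact (ENNReal.pow_lt_top_iff.1 this).resolve_right (by norm_num)
    refine (h1.add (integrable_const (φ z₀))).congr (Filter.Eventually.of_forall fun z => ?_)
    simp
  refine ⟨hint, le_trans (lintegral_mono fun z => ?_) hI⟩
  refine le_trans ?_ (hcs z)
  refine pow_le_pow_left' ?_ 2
  have : φ z - ∫ z', φ z' ∂π = ∫ z', (φ z - φ z') ∂π := by
    rw [integral_sub (integrable_const _) hint]
    simp
  rw [this]
  refine (enorm_integral_le_lintegral_enorm _).trans (le_of_eq ?_)
  refine lintegral_congr fun z' => ?_
  rw [← enorm_neg, neg_sub]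

variable {V : Type*} [NormedAddCommGroup V] [InnerProductSpace ℝ V] [FiniteDimensional ℝ V]
  [MeasurableSpace V] [BorelSpace V]

/-- The Poincaré inequality for a probability density satisfying the kernel bound. -/
theorem SegmentKernelBound.poincare {q φ : V → ℝ} {h : V → ENNReal} {w : ℝ → ENNReal}
    {C : ENNReal} (hq : Measurable q) (hq0 : ∀ z, 0 ≤ q z)
    (hq1 : ∫⁻ z, ENNReal.ofReal (q z) = 1) (hφ : Measurable φ)
    (hh : Measurable h) (hw : Measurable w) (h0 : ∀ s ∈ Set.Ioo (0 : ℝ) 1, w s ≠ 0 ∧ w s ≠ ⊤)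
    (hker : SegmentKernelBound (fun z => ENNReal.ofReal (q z)) w C)
    (hD : ∀ᵐ z, ∀ᵐ v, q z * q (z + v) ≠ 0 →
      ‖φ (z + v) - φ z‖ₑ ≤ ∫⁻ s in Set.Ioo (0 : ℝ) 1, ‖v‖ₑ * h (z + s • v))
    (hfin : (∫⁻ s in Set.Ioo (0 : ℝ) 1, w s) * C *
      ∫⁻ z, h z ^ 2 * ENNReal.ofReal (q z) ≠ ⊤) :
    Integrable (fun z => φ z * q z) ∧
      ∫⁻ z, ‖φ z - ∫ z', φ z' * q z'‖ₑ ^ 2 * ENNReal.ofReal (q z) ≤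
        (∫⁻ s in Set.Ioo (0 : ℝ) 1, w s) * C * ∫⁻ z, h z ^ 2 * ENNReal.ofReal (q z) := by
  have hrm : Measurable fun z => ENNReal.ofReal (q z) := hq.ennreal_ofReal
  have key := hker.lintegral_pair_le hrm hh hw h0 (D := fun z v => ‖φ (z + v) - φ z‖ₑ)
    (hD.mono fun z hz => hz.mono fun v hv hr => hv fun h => hr (by
      rw [← ENNReal.ofReal_mul (hq0 _), h, ENNReal.ofReal_zero]))
  set π : Measure V := volume.withDensity fun z => ENNReal.ofReal (q z) with hπ
  have : IsProbabilityMeasure π := ⟨by simp [hπ, hq1]⟩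
  have hlin : ∀ g : V → ENNReal, Measurable g →
      ∫⁻ z, g z ∂π = ∫⁻ z, g z * ENNReal.ofReal (q z) := fun g hg => by
    rw [hπ, lintegral_withDensity_eq_lintegral_mul _ hrm hg]
    simp only [Pi.mul_apply, mul_comm]
  have hI : ∫⁻ z, ∫⁻ z', ‖φ z' - φ z‖ₑ ^ 2 ∂π ∂π ≤
      (∫⁻ s in Set.Ioo (0 : ℝ) 1, w s) * C * ∫⁻ z, h z ^ 2 * ENNReal.ofReal (q z) := by
    refine le_trans (le_of_eq ?_) key
    have hm : Measurable fun z => ∫⁻ z', ‖φ z' - φ z‖ₑ ^ 2 ∂π := by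
      have : Measurable fun q : V × V => ‖φ q.2 - φ q.1‖ₑ ^ 2 := by fun_prop
      exact this.lintegral_prod_right'
    rw [hlin _ hm]
    refine lintegral_congr fun z => ?_
    -- The second sample point is written as `z + v`.
    rw [hlin _ (by fun_prop), ← lintegral_mul_const _ (by fun_prop),
      ← lintegral_add_left_eq_self _ z]
    refine lintegral_congr fun v => ?_
    ring
  obtain ⟨h1, h2⟩ := integrable_and_lintegral_sub_integral_sq_le hφ hI hfin
  have hmean : ∫ z', φ z' ∂π = ∫ z', φ z' * q z' := by
    rw [hπ, integral_withDensity_eq_integral_toReal_smul hrm (by simp)]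
    refine integral_congr_ae (Filter.Eventually.of_forall fun z => ?_)
    simp [ENNReal.toReal_ofReal (hq0 z), mul_comm]
  refine ⟨?_, ?_⟩
  · rw [hπ, integrable_withDensity_iff hrm (by simp)] at h1
    simpa [ENNReal.toReal_ofReal (hq0 _)] using h1
  · rw [hlin _ (by fun_prop), hmean] at h2
    exact h2

end Variance

/-! ### The orthogonal change of variables `x = W₁ y + W₂ z` -/

section Rotation

variable {n k : ℕ} (hk : k < n) {W : Matrix (Fin n) (Fin n) ℝ}

/-- The inactive variable `z = W₂ᵀ x`. -/
noncomputable def inactiveVariable (W : Matrix (Fin n) (Fin n) ℝ)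
    (x : EuclideanSpace ℝ (Fin n)) : EuclideanSpace ℝ (Fin (n - k)) :=
  WithLp.toLp 2 ((inactiveColumns hk W)ᵀ *ᵥ x.ofLp)

theorem orthogonal_columns (hW : W ∈ Matrix.orthogonalGroup (Fin n) ℝ) (a b : Fin n) :
    ∑ i, W i a * W i b = if a = b then 1 else 0 := by
  have h := (Matrix.mem_orthogonalGroup_iff' (Fin n) ℝ).1 hW
  have := congrFun (congrFun h a) b
  simpa [Matrix.mul_apply, Matrix.one_apply, Matrix.star_eq_conjTranspose] using this

theorem activeColumns_transpose_mul_self (hW : W ∈ Matrix.orthogonalGroup (Fin n) ℝ) :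
    (activeColumns hk W)ᵀ * activeColumns hk W = 1 := by
  ext a b
  simp [Matrix.mul_apply, activeColumns, orthogonal_columns hW, Matrix.one_apply, Fin.ext_iff]

theorem inactiveColumns_transpose_mul_self (hW : W ∈ Matrix.orthogonalGroup (Fin n) ℝ) :
    (inactiveColumns hk W)ᵀ * inactiveColumns hk W = 1 := by
  ext a b
  simp [Matrix.mul_apply, inactiveColumns, orthogonal_columns hW, Matrix.one_apply, Fin.ext_iff]

theorem activeColumns_transpose_mul_inactiveColumns
    (hW : W ∈ Matrix.orthogonalGroup (Fin n) ℝ) :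
    (activeColumns hk W)ᵀ * inactiveColumns hk W = 0 := by
  ext a b
  have : (a : ℕ) ≠ k + b := by omega
  simp [Matrix.mul_apply, activeColumns, inactiveColumns, orthogonal_columns hW, Fin.ext_iff, this]

theorem activeVariable_pointOf (hW : W ∈ Matrix.orthogonalGroup (Fin n) ℝ)
    (y : EuclideanSpace ℝ (Fin k)) (z : EuclideanSpace ℝ (Fin (n - k))) :
    activeVariable hk W (pointOf hk W y z) = y := by
  simp [activeVariable, pointOf, Matrix.mulVec_add, Matrix.mulVec_mulVec,
    activeColumns_transpose_mul_self hk hW, activeColumns_transpose_mul_inactiveColumns hk hW]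

theorem norm_sq_pointOf (hW : W ∈ Matrix.orthogonalGroup (Fin n) ℝ)
    (y : EuclideanSpace ℝ (Fin k)) (z : EuclideanSpace ℝ (Fin (n - k))) :
    ‖pointOf hk W y z‖ ^ 2 = ‖y‖ ^ 2 + ‖z‖ ^ 2 := by
  have h3 : (inactiveColumns hk W)ᵀ * activeColumns hk W = 0 := by
    rw [← Matrix.transpose_transpose (activeColumns hk W), ← Matrix.transpose_mul,
      activeColumns_transpose_mul_inactiveColumns hk hW, Matrix.transpose_zero]
  have hn : ∀ {m : ℕ} (x : EuclideanSpace ℝ (Fin m)), ‖x‖ ^ 2 = x.ofLp ⬝ᵥ x.ofLp := fun x => by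
    rw [EuclideanSpace.norm_sq_eq]
    simp [dotProduct, ← sq]
  have hmv : ∀ {a b c : ℕ} (A : Matrix (Fin a) (Fin b) ℝ) (B : Matrix (Fin a) (Fin c) ℝ)
      (u : Fin b → ℝ) (v : Fin c → ℝ), (A *ᵥ u) ⬝ᵥ (B *ᵥ v) = u ⬝ᵥ ((Aᵀ * B) *ᵥ v) := by
    intro a b c A B u v
    rw [← Matrix.mulVec_mulVec, Matrix.dotProduct_mulVec u, Matrix.vecMul_transpose]
  rw [hn, hn, hn, pointOf]
  simp only [add_dotProduct, dotProduct_add, hmv]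
  rw [activeColumns_transpose_mul_self hk hW, inactiveColumns_transpose_mul_self hk hW,
    activeColumns_transpose_mul_inactiveColumns hk hW, h3]
  simp

theorem pointOf_add_smul (y : EuclideanSpace ℝ (Fin k)) (z v : EuclideanSpace ℝ (Fin (n - k)))
    (s : ℝ) : pointOf hk W y (z + s • v) = pointOf hk W y z + s • pointOf hk W 0 v := by
  ext i
  simp [pointOf, Matrix.mulVec_add, Matrix.mulVec_smul]
  ring

theorem pointOf_add (y : EuclideanSpace ℝ (Fin k)) (z v : EuclideanSpace ℝ (Fin (n - k))) :
    pointOf hk W y (z + v) = pointOf hk W y z + pointOf hk W 0 v := by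
  simpa using pointOf_add_smul hk (W := W) y z v 1

theorem inner_pointOf_zero (x : EuclideanSpace ℝ (Fin n)) (v : EuclideanSpace ℝ (Fin (n - k))) :
    inner ℝ x (pointOf hk W 0 v) = inner ℝ (inactiveVariable hk W x) v := by
  simp only [EuclideanSpace.inner_eq_star_dotProduct, pointOf, inactiveVariable]
  simp only [star_trivial, WithLp.ofLp_zero, Matrix.mulVec_zero, zero_add]
  rw [dotProduct_comm, Matrix.dotProduct_mulVec, Matrix.mulVec_transpose, dotProduct_comm]

/-- The map `(y, z) ↦ W₁ y + W₂ z` as a linear isometry of Euclidean spaces. -/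
noncomputable def pointOfIsometry (hW : W ∈ Matrix.orthogonalGroup (Fin n) ℝ) :
    WithLp 2 (EuclideanSpace ℝ (Fin k) × EuclideanSpace ℝ (Fin (n - k))) ≃ₗᵢ[ℝ]
      EuclideanSpace ℝ (Fin n) :=
  LinearIsometry.toLinearIsometryEquiv
    { toFun := fun p => pointOf hk W p.fst p.snd
      map_add' := fun p q => by
        ext i
        simp [pointOf, Matrix.mulVec_add]
        ring
      map_smul' := fun c p => by
        ext i
        simp [pointOf, Matrix.mulVec_smul]
      norm_map' := fun p => by
        have h := norm_sq_pointOf hk hW p.fst p.snd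
        rw [← WithLp.prod_norm_sq_eq_of_L2] at h
        exact (sq_eq_sq₀ (norm_nonneg _) (norm_nonneg _)).1 h }
    (by
      rw [LinearEquiv.finrank_eq (WithLp.linearEquiv 2 ℝ _)]
      simp [hk.le])

theorem measurePreserving_pointOf (hW : W ∈ Matrix.orthogonalGroup (Fin n) ℝ) :
    MeasurePreserving (fun p : EuclideanSpace ℝ (Fin k) × EuclideanSpace ℝ (Fin (n - k)) =>
      pointOf hk W p.1 p.2) (volume.prod volume) volume :=
  (pointOfIsometry hk hW).measurePreserving.comp (WithLp.volume_preserving_toLp _ _)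

@[fun_prop]
theorem continuous_pointOf :
    Continuous (fun p : EuclideanSpace ℝ (Fin k) × EuclideanSpace ℝ (Fin (n - k)) =>
      pointOf hk W p.1 p.2) := by
  unfold pointOf
  fun_prop

@[fun_prop]
theorem continuous_activeVariable : Continuous (activeVariable hk W) := by
  unfold activeVariable
  fun_prop

@[fun_prop]
theorem continuous_inactiveVariable : Continuous (inactiveVariable hk W) := by
  unfold inactiveVariable
  fun_prop

/-- A property of the active variable that holds almost everywhere holds at the active variable of
almost every point. -/
theorem ae_activeVariable (hW : W ∈ Matrix.orthogonalGroup (Fin n) ℝ)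
    {p : EuclideanSpace ℝ (Fin k) → Prop} (hp : ∀ᵐ y, p y) :
    ∀ᵐ x, p (activeVariable hk W x) := by
  have hx := (measurePreserving_pointOf hk hW)
  obtain ⟨N, hN, hNm, hN0⟩ := exists_measurable_superset_of_null hp
  have h2 : ∀ᵐ x, activeVariable hk W x ∉ N := by
    rw [← hx.map_eq, ae_map_iff hx.aemeasurable]
    · simp only [activeVariable_pointOf hk hW]
      exact Measure.quasiMeasurePreserving_fst.ae (measure_eq_zero_iff_ae_notMem.1 hN0)
    · exact (hNm.preimage (continuous_activeVariable hk).measurable).compl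
  refine h2.mono fun x hx => ?_
  by_contra hc
  exact hx (hN hc)

end Rotation

/-! ### Poincaré inequality on slices, and integration over the active variable -/

section ConditionalPoincare

variable {n k : ℕ} (hk : k < n) {W : Matrix (Fin n) (Fin n) ℝ}

theorem measurable_activeDensity {ρ : EuclideanSpace ℝ (Fin n) → ℝ} (hρ : Measurable ρ) :
    Measurable (activeDensity hk W ρ) := by
  have : StronglyMeasurable (Function.uncurry (jointDensity hk W ρ)) :=
    (hρ.comp (continuous_pointOf hk).measurable).stronglyMeasurable
  exact this.integral_prod_right.measurable

theorem measurable_condMean {ρ F : EuclideanSpace ℝ (Fin n) → ℝ} (hρ : Measurable ρ)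
    (hF : Measurable F) : Measurable (condMean hk W ρ F) := by
  have h1 := (continuous_pointOf hk (W := W)).measurable
  have : Measurable (Function.uncurry fun (y : EuclideanSpace ℝ (Fin k))
      (z : EuclideanSpace ℝ (Fin (n - k))) =>
      F (pointOf hk W y z) * condDensity hk W ρ y z) :=
    (hF.comp h1).mul ((hρ.comp h1).div
      ((measurable_activeDensity hk hρ).comp measurable_fst))
  exact this.stronglyMeasurable.integral_prod_right.measurable

theorem measurable_ridgeApprox {ρ F : EuclideanSpace ℝ (Fin n) → ℝ} (hρ : Measurable ρ)
    (hF : Measurable F) : Measurable (ridgeApprox hk W ρ F) :=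
  (measurable_condMean hk hρ hF).comp (continuous_activeVariable hk).measurable

theorem lintegral_eq_lintegral_pointOf (hW : W ∈ Matrix.orthogonalGroup (Fin n) ℝ)
    {Φ : EuclideanSpace ℝ (Fin n) → ENNReal} (hΦ : Measurable Φ) :
    ∫⁻ x, Φ x = ∫⁻ y, ∫⁻ z, Φ (pointOf hk W y z) := by
  rw [← (measurePreserving_pointOf hk hW).lintegral_comp hΦ, lintegral_prod]
  exact (hΦ.comp (continuous_pointOf hk).measurable).aemeasurable

theorem ae_pointOf (hW : W ∈ Matrix.orthogonalGroup (Fin n) ℝ)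
    {p : EuclideanSpace ℝ (Fin n) → Prop} (hp : ∀ᵐ x, p x) :
    ∀ᵐ y, ∀ᵐ z, p (pointOf hk W y z) :=
  Measure.ae_ae_of_ae_prod ((measurePreserving_pointOf hk hW).quasiMeasurePreserving.ae hp)

/-- Almost every slice in the inactive directions satisfies the fundamental theorem of calculus
along almost every segment. -/
theorem ae_slice_ftc (hW : W ∈ Matrix.orthogonalGroup (Fin n) ℝ)
    {U : Set (EuclideanSpace ℝ (Fin n))} (hU : MeasurableSet U)
    {F : EuclideanSpace ℝ (Fin n) → ℝ}
    {G : EuclideanSpace ℝ (Fin n) → EuclideanSpace ℝ (Fin n)} (hF : Measurable F)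
    (hG : Measurable G) (hftc : ∀ u, LineFTC U F G u) :
    ∀ᵐ y, ∀ᵐ z, ∀ᵐ v, pointOf hk W y z ∈ U → pointOf hk W y (z + v) ∈ U →
      F (pointOf hk W y (z + v)) - F (pointOf hk W y z) =
        ∫ s in (0 : ℝ)..1, inner ℝ (inactiveVariable hk W (G (pointOf hk W y (z + s • v)))) v := by
  have hL : Continuous fun v : EuclideanSpace ℝ (Fin (n - k)) => pointOf hk W 0 v :=
    (continuous_pointOf hk).comp (Continuous.prodMk continuous_const continuous_id)
  have hLm := hL.measurable
  have hI : Measurable fun q : EuclideanSpace ℝ (Fin n) × EuclideanSpace ℝ (Fin (n - k)) =>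
      ∫ s in (0 : ℝ)..1, inner ℝ (G (q.1 + s • pointOf hk W 0 q.2)) (pointOf hk W 0 q.2) := by
    simp only [intervalIntegral.integral_of_le zero_le_one]
    have : StronglyMeasurable (Function.uncurry
        fun (q : EuclideanSpace ℝ (Fin n) × EuclideanSpace ℝ (Fin (n - k))) (s : ℝ) =>
        (inner ℝ (G (q.1 + s • pointOf hk W 0 q.2)) (pointOf hk W 0 q.2) : ℝ)) := by
      apply Measurable.stronglyMeasurable
      simp only [Function.uncurry_def]
      fun_prop
    exact this.integral_prod_right.measurable
  have hset : MeasurableSet {q : EuclideanSpace ℝ (Fin n) × EuclideanSpace ℝ (Fin (n - k)) |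
      q.1 ∈ U → q.1 + pointOf hk W 0 q.2 ∈ U →
      F (q.1 + pointOf hk W 0 q.2) - F q.1 =
        ∫ s in (0 : ℝ)..1, inner ℝ (G (q.1 + s • pointOf hk W 0 q.2)) (pointOf hk W 0 q.2)} := by
    have hadd : Measurable fun q : EuclideanSpace ℝ (Fin n) × EuclideanSpace ℝ (Fin (n - k)) =>
      q.1 + pointOf hk W 0 q.2 := by fun_prop
    refine MeasurableSet.imp (hU.preimage measurable_fst) (MeasurableSet.imp (hU.preimage hadd) ?_)
    exact measurableSet_eq_fun ((hF.comp hadd).sub (hF.comp measurable_fst)) hI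
  -- For each `v` the identity holds at almost every `x`. Measurability of the good set allows the
  -- quantifiers to be exchanged, after which the points `x` are distributed over the slices.
  have h1 := (Measure.ae_ae_comm (μ := (volume : Measure (EuclideanSpace ℝ (Fin n))))
    (ν := (volume : Measure (EuclideanSpace ℝ (Fin (n - k))))) hset).2
    (Filter.Eventually.of_forall fun v => hftc (pointOf hk W 0 v))
  refine (ae_pointOf hk hW h1).mono fun y hy => hy.mono fun z hz => hz.mono fun v hv => ?_
  intro hz1 hz2
  rw [pointOf_add] at hz2 ⊢
  rw [hv hz1 hz2]
  refine intervalIntegral.integral_congr fun s _ => ?_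
  simp only [pointOf_add_smul, inner_pointOf_zero]

theorem lintegral_condDensity {ρ : EuclideanSpace ℝ (Fin n) → ℝ} (hρ0 : ∀ x, 0 ≤ ρ x) {y : EuclideanSpace ℝ (Fin k)}
    (hy : 0 < activeDensity hk W ρ y) :
    ∫⁻ z, ENNReal.ofReal (condDensity hk W ρ y z) = 1 := by
  -- Otherwise the integral defining `activeDensity` would take the default value `0`.
  have hi : Integrable (jointDensity hk W ρ y) := by
    by_contra h
    rw [activeDensity, integral_undef h] at hy
    exact lt_irrefl _ hy
  have hi' : Integrable (condDensity hk W ρ y) := hi.div_const _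
  rw [← ofReal_integral_eq_lintegral_ofReal hi'
    (Filter.Eventually.of_forall fun z => div_nonneg (hρ0 _) hy.le)]
  have : ∫ z, condDensity hk W ρ y z = 1 := by
    simp only [condDensity]
    rw [integral_div]
    exact div_self hy.ne'
  rw [this, ENNReal.ofReal_one]

/-- The conditional Poincaré inequality on one slice. -/
theorem slice_poincare {ρ F : EuclideanSpace ℝ (Fin n) → ℝ} (hρ : Measurable ρ)
    (hρ0 : ∀ x, 0 ≤ ρ x)
    {G : EuclideanSpace ℝ (Fin n) → EuclideanSpace ℝ (Fin n)} (hF : Measurable F)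
    (hG : Measurable G) {w : ℝ → ENNReal} (hw : Measurable w)
    (h0 : ∀ s ∈ Set.Ioo (0 : ℝ) 1, w s ≠ 0 ∧ w s ≠ ⊤)
    (hκ : ∫⁻ s in Set.Ioo (0 : ℝ) 1, w s ≠ ⊤) {C : ENNReal} (hC : C ≠ ⊤)
    {y : EuclideanSpace ℝ (Fin k)}
    (hker : 0 < activeDensity hk W ρ y →
      SegmentKernelBound (fun z => ENNReal.ofReal (condDensity hk W ρ y z)) w C)
    (hmass : Integrable (jointDensity hk W ρ y))
    (hftc : ∀ᵐ z, ∀ᵐ v, pointOf hk W y z ∈ densitySupport ρ →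
      pointOf hk W y (z + v) ∈ densitySupport ρ →
      F (pointOf hk W y (z + v)) - F (pointOf hk W y z) =
        ∫ s in (0 : ℝ)..1, inner ℝ (inactiveVariable hk W (G (pointOf hk W y (z + s • v)))) v)
    (hfin : ∫⁻ z, ‖inactiveVariable hk W (G (pointOf hk W y z))‖ₑ ^ 2 *
      ENNReal.ofReal (ρ (pointOf hk W y z)) ≠ ⊤) :
    Integrable (fun z => F (pointOf hk W y z) * condDensity hk W ρ y z) ∧
      ∫⁻ z, ‖F (pointOf hk W y z) - condMean hk W ρ F y‖ₑ ^ 2 *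
          ENNReal.ofReal (ρ (pointOf hk W y z)) ≤
        (∫⁻ s in Set.Ioo (0 : ℝ) 1, w s) * C *
          ∫⁻ z, ‖inactiveVariable hk W (G (pointOf hk W y z))‖ₑ ^ 2 *
            ENNReal.ofReal (ρ (pointOf hk W y z)) := by
  have hpt : Measurable fun z => pointOf hk W y z :=
    ((continuous_pointOf hk).comp (Continuous.prodMk continuous_const continuous_id)).measurable
  have hj0 : ∀ z, 0 ≤ jointDensity hk W ρ y z := fun z => hρ0 _
  have ha0 : 0 ≤ activeDensity hk W ρ y := integral_nonneg hj0
  have hinm : Measurable (inactiveVariable hk W) := (continuous_inactiveVariable hk).measurable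
  -- If `ρ_Y(y) = 0`, the quotient `condDensity` is `0` by convention. Integrability of the slice
  -- rules out that this zero is a default value, so `ρ` vanishes almost everywhere on the slice.
  rcases ha0.eq_or_lt with ha | ha
  · constructor
    · simp [condDensity, ← ha]
    · have hz := (integral_eq_zero_iff_of_nonneg hj0 hmass).1 ha.symm
      refine le_trans (le_of_eq ?_) bot_le
      rw [bot_eq_zero, lintegral_eq_zero_iff' (by fun_prop)]
      filter_upwards [hz] with z hz
      have : ρ (pointOf hk W y z) = 0 := hz
      simp [this]
  · have hq : Measurable (condDensity hk W ρ y) := (hρ.comp hpt).div_const _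
    have hq0 : ∀ z, 0 ≤ condDensity hk W ρ y z := fun z => div_nonneg (hj0 z) ha.le
    have hq1 := lintegral_condDensity hk hρ0 ha
    -- The inequality is for the conditional density; multiplying by `ρ_Y(y)` turns it into one for
    -- `ρ`, ready to be integrated in `y`.
    have hsplit : ∀ z, ENNReal.ofReal (ρ (pointOf hk W y z)) =
        ENNReal.ofReal (activeDensity hk W ρ y) * ENNReal.ofReal (condDensity hk W ρ y z) := by
      intro z
      rw [← ENNReal.ofReal_mul ha.le, condDensity, mul_div_cancel₀ _ ha.ne']
      rfl
    have hout : ∀ g : EuclideanSpace ℝ (Fin (n - k)) → ENNReal, Measurable g →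
        ∫⁻ z, g z * ENNReal.ofReal (ρ (pointOf hk W y z)) =
          ENNReal.ofReal (activeDensity hk W ρ y) *
            ∫⁻ z, g z * ENNReal.ofReal (condDensity hk W ρ y z) := by
      intro g hg
      rw [← lintegral_const_mul _ (by fun_prop)]
      refine lintegral_congr fun z => ?_
      rw [hsplit]
      ring
    have hane : ENNReal.ofReal (activeDensity hk W ρ y) ≠ 0 := by simpa using ha
    rw [hout _ (by fun_prop)] at hfin ⊢
    have hfin' : ∫⁻ z, ‖inactiveVariable hk W (G (pointOf hk W y z))‖ₑ ^ 2 *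
        ENNReal.ofReal (condDensity hk W ρ y z) ≠ ⊤ := fun h => hfin (by
      rw [h, ENNReal.mul_top hane])
    have hD : ∀ᵐ z, ∀ᵐ v, condDensity hk W ρ y z * condDensity hk W ρ y (z + v) ≠ 0 →
        ‖F (pointOf hk W y (z + v)) - F (pointOf hk W y z)‖ₑ ≤ ∫⁻ s in Set.Ioo (0 : ℝ) 1,
          ‖v‖ₑ * ‖inactiveVariable hk W (G (pointOf hk W y (z + s • v)))‖ₑ := by
      refine hftc.mono fun z hz => hz.mono fun v hv hqq => ?_
      have hpos : ∀ z', condDensity hk W ρ y z' ≠ 0 → pointOf hk W y z' ∈ densitySupport ρ :=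
        fun z' h => lt_of_le_of_ne (hρ0 _) fun h' => h (by
          rw [condDensity, jointDensity, ← h', zero_div])
      rw [hv (hpos _ (left_ne_zero_of_mul hqq)) (hpos _ (right_ne_zero_of_mul hqq)),
        intervalIntegral.integral_of_le zero_le_one, restrict_Ioo_eq_restrict_Ioc]
      refine (enorm_integral_le_lintegral_enorm _).trans (lintegral_mono fun s => ?_)
      rw [mul_comm, ← enorm_norm v, ← enorm_norm (inactiveVariable hk W _), ← enorm_mul]
      exact enorm_le_iff_norm_le.2 (by simpa using norm_inner_le_norm (𝕜 := ℝ) _ v)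
    obtain ⟨h1, h2⟩ := (hker ha).poincare hq hq0 hq1 (φ := fun z => F (pointOf hk W y z))
      (h := fun z => ‖inactiveVariable hk W (G (pointOf hk W y z))‖ₑ) (by fun_prop) (by fun_prop)
      hw h0 hD (ENNReal.mul_ne_top (ENNReal.mul_ne_top hκ hC) hfin')
    refine ⟨h1, ?_⟩
    rw [hout _ (by fun_prop), mul_left_comm]
    exact mul_le_mul_right h2 _

/-- The conditional Poincaré inequality. -/
theorem conditional_poincare (hW : W ∈ Matrix.orthogonalGroup (Fin n) ℝ)
    {ρ F : EuclideanSpace ℝ (Fin n) → ℝ} (hρ : Measurable ρ)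
    (hρ0 : ∀ x, 0 ≤ ρ x) (hρfin : ∫⁻ x, ENNReal.ofReal (ρ x) ≠ ⊤)
    {G : EuclideanSpace ℝ (Fin n) → EuclideanSpace ℝ (Fin n)} (hF : Measurable F)
    (hG : Measurable G) (hftc : ∀ u, LineFTC (densitySupport ρ) F G u)
    {w : ℝ → ENNReal} (hw : Measurable w)
    (h0 : ∀ s ∈ Set.Ioo (0 : ℝ) 1, w s ≠ 0 ∧ w s ≠ ⊤)
    (hκ : ∫⁻ s in Set.Ioo (0 : ℝ) 1, w s ≠ ⊤) {C : ENNReal} (hC : C ≠ ⊤)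
    (hker : ∀ y, 0 < activeDensity hk W ρ y →
      SegmentKernelBound (fun z => ENNReal.ofReal (condDensity hk W ρ y z)) w C)
    (hfin : ∫⁻ x, ‖inactiveVariable hk W (G x)‖ₑ ^ 2 * ENNReal.ofReal (ρ x) ≠ ⊤) :
    (∀ᵐ y, Integrable fun z => F (pointOf hk W y z) * condDensity hk W ρ y z) ∧
      ∫⁻ x, ‖F x - ridgeApprox hk W ρ F x‖ₑ ^ 2 * ENNReal.ofReal (ρ x) ≤
        (∫⁻ s in Set.Ioo (0 : ℝ) 1, w s) * C *
          ∫⁻ x, ‖inactiveVariable hk W (G x)‖ₑ ^ 2 * ENNReal.ofReal (ρ x) := by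
  have hpt := (continuous_pointOf hk (W := W)).measurable
  have hinm : Measurable (inactiveVariable hk W) := (continuous_inactiveVariable hk).measurable
  have hridge := measurable_ridgeApprox hk (W := W) hρ hF
  have hgm : Measurable fun x => ‖inactiveVariable hk W (G x)‖ₑ ^ 2 * ENNReal.ofReal (ρ x) := by
    fun_prop
  have hsm : Measurable fun y => ∫⁻ z, ‖inactiveVariable hk W (G (pointOf hk W y z))‖ₑ ^ 2 *
      ENNReal.ofReal (ρ (pointOf hk W y z)) := (hgm.comp hpt).lintegral_prod_right'
  have hfin' : ∀ᵐ y, ∫⁻ z, ‖inactiveVariable hk W (G (pointOf hk W y z))‖ₑ ^ 2 *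
      ENNReal.ofReal (ρ (pointOf hk W y z)) < ⊤ := by
    rw [lintegral_eq_lintegral_pointOf hk hW hgm] at hfin
    exact ae_lt_top hsm hfin
  have hmass : ∀ᵐ y, Integrable (jointDensity hk W ρ y) := by
    rw [lintegral_eq_lintegral_pointOf hk hW hρ.ennreal_ofReal] at hρfin
    have hm : Measurable fun y => ∫⁻ z, ENNReal.ofReal (ρ (pointOf hk W y z)) :=
      (hρ.ennreal_ofReal.comp hpt).lintegral_prod_right'
    filter_upwards [ae_lt_top hm hρfin] with y hy
    refine ⟨(hρ.comp (hpt.comp measurable_prodMk_left)).aestronglyMeasurable, ?_⟩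
    have hnn : ∀ᵐ z, 0 ≤ jointDensity hk W ρ y z := Filter.Eventually.of_forall fun z => hρ0 _
    rw [hasFiniteIntegral_iff_ofReal hnn]
    exact hy
  have hopen : MeasurableSet (densitySupport ρ) := measurableSet_lt measurable_const hρ
  have key : ∀ᵐ y, Integrable (fun z => F (pointOf hk W y z) * condDensity hk W ρ y z) ∧
      ∫⁻ z, ‖F (pointOf hk W y z) - condMean hk W ρ F y‖ₑ ^ 2 *
          ENNReal.ofReal (ρ (pointOf hk W y z)) ≤
        (∫⁻ s in Set.Ioo (0 : ℝ) 1, w s) * C *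
          ∫⁻ z, ‖inactiveVariable hk W (G (pointOf hk W y z))‖ₑ ^ 2 *
            ENNReal.ofReal (ρ (pointOf hk W y z)) := by
    filter_upwards [hfin', hmass, ae_slice_ftc hk hW hopen hF hG hftc] with y h1 h2 h3
    exact slice_poincare hk hρ hρ0 hF hG hw h0 hκ hC (hker y) h2 h3 h1.ne
  refine ⟨key.mono fun y hy => hy.1, ?_⟩
  rw [lintegral_eq_lintegral_pointOf hk hW hgm,
    lintegral_eq_lintegral_pointOf hk hW (by fun_prop), ← lintegral_const_mul _ hsm]
  refine lintegral_mono_ae (key.mono fun y hy => le_trans (le_of_eq ?_) hy.2)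
  refine lintegral_congr fun z => ?_
  rw [ridgeApprox, activeVariable_pointOf hk hW]

end ConditionalPoincare

/-! ### The two admissible laws -/

section Densities

theorem integrable_exp_neg_sq_norm_div_two {V : Type*} [NormedAddCommGroup V]
    [InnerProductSpace ℝ V] [FiniteDimensional ℝ V] [MeasurableSpace V] [BorelSpace V] :
    Integrable fun v : V => Real.exp (-‖v‖ ^ 2 / 2) := by
  have h := lintegral_exp_neg_mul_sq_norm_lt_top (V := V) (b := 1 / 2) (by norm_num)
  have h2 : (fun v : V => Real.exp (-‖v‖ ^ 2 / 2)) = fun v => Real.exp (-(1 / 2) * ‖v‖ ^ 2) := by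
    funext v; congr 1; ring
  rw [h2]
  refine ⟨by fun_prop, ?_⟩
  rwa [hasFiniteIntegral_iff_ofReal (Filter.Eventually.of_forall fun z => (Real.exp_pos _).le)]

/-- The standard Gaussian measure has the expected Lebesgue density. -/
theorem stdGaussian_eq_withDensity {V : Type*} [NormedAddCommGroup V]
    [InnerProductSpace ℝ V] [FiniteDimensional ℝ V] [MeasurableSpace V] [BorelSpace V] :
    stdGaussian V = volume.withDensity fun x : V =>
      ENNReal.ofReal ((∫ v : V, Real.exp (-‖v‖ ^ 2 / 2))⁻¹ * Real.exp (-‖x‖ ^ 2 / 2)) := by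
  set c := ∫ v : V, Real.exp (-‖v‖ ^ 2 / 2) with hc
  have hcpos : 0 < c := integral_exp_pos integrable_exp_neg_sq_norm_div_two
  have hint : Integrable fun x : V => c⁻¹ * Real.exp (-‖x‖ ^ 2 / 2) :=
    integrable_exp_neg_sq_norm_div_two.const_mul _
  have : IsFiniteMeasure (volume.withDensity fun x : V =>
      ENNReal.ofReal (c⁻¹ * Real.exp (-‖x‖ ^ 2 / 2))) :=
    isFiniteMeasure_withDensity_ofReal hint.2
  refine Measure.ext_of_charFun (funext fun t => ?_)
  rw [charFun_stdGaussian, charFun_apply,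
    integral_withDensity_eq_integral_toReal_smul (by fun_prop) (by simp)]
  have h1 := GaussianFourier.integral_cexp_neg_mul_sq_norm_add (V := V) (b := 1 / 2)
    (by norm_num) Complex.I t
  -- The same formula with `0` in place of `i` evaluates the normalising constant, so the powers of
  -- `π` cancel without being computed.
  have h2 := GaussianFourier.integral_cexp_neg_mul_sq_norm_add (V := V) (b := 1 / 2)
    (by norm_num) 0 t
  have h3 : ∫ v : V, Complex.exp (-(1 / 2) * (‖v‖ : ℂ) ^ 2 + 0 * (inner ℝ t v : ℝ)) = c := by
    rw [hc, ← integral_complex_ofReal]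
    refine integral_congr_ae (Filter.Eventually.of_forall fun v => ?_)
    simp only [zero_mul, add_zero, Complex.ofReal_exp]
    congr 1
    push_cast
    ring
  rw [h3] at h2
  have h4 : ∀ x : V, (ENNReal.ofReal (c⁻¹ * Real.exp (-‖x‖ ^ 2 / 2))).toReal •
      Complex.exp ((inner ℝ x t : ℝ) * Complex.I) =
      (c : ℂ)⁻¹ * Complex.exp (-(1 / 2) * (‖x‖ : ℂ) ^ 2 + Complex.I * (inner ℝ t x : ℝ)) := by
    intro x
    rw [ENNReal.toReal_ofReal (by positivity), Complex.real_smul, Complex.exp_add,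
      real_inner_comm]
    push_cast
    have : (-(1 / 2) * (‖x‖ : ℂ) ^ 2) = -(‖x‖ : ℂ) ^ 2 / 2 := by ring
    rw [this, mul_comm Complex.I, mul_assoc]
  simp only [h4]
  rw [integral_const_mul, h1]
  have h5 : (0 : ℂ) ^ 2 * (‖t‖ : ℂ) ^ 2 / (4 * (1 / 2)) = 0 := by ring
  rw [h5, Complex.exp_zero, mul_one] at h2
  rw [← h2, ← mul_assoc, inv_mul_cancel₀ (by exact_mod_cast hcpos.ne'), one_mul, Complex.I_sq]
  congr 1
  ring

/-- The conditional densities of `ρ` given the active variables satisfy a common kernel bound. -/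
def HasConditionalKernelBound {n : ℕ} (ρ : EuclideanSpace ℝ (Fin n) → ℝ) : Prop :=
  ∃ (w : ℝ → ENNReal) (C : ENNReal), Measurable w ∧
    (∀ s ∈ Set.Ioo (0 : ℝ) 1, w s ≠ 0 ∧ w s ≠ ⊤) ∧ ∫⁻ s in Set.Ioo (0 : ℝ) 1, w s ≠ ⊤ ∧ C ≠ ⊤ ∧
    ∀ (W : Matrix (Fin n) (Fin n) ℝ), W ∈ Matrix.orthogonalGroup (Fin n) ℝ →
      ∀ (k : ℕ) (hk : k < n) (y : EuclideanSpace ℝ (Fin k)), 0 < activeDensity hk W ρ y →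
        SegmentKernelBound (fun z => ENNReal.ofReal (condDensity hk W ρ y z)) w C

/-- Each slice of the support is convex with diameter at most `d`, and the conditional density is
constant on it. The factor `2 ^ n` covers every slice dimension `n - k`. -/
theorem hasConditionalKernelBound_of_const {n : ℕ} {ρ : EuclideanSpace ℝ (Fin n) → ℝ}
    (hρ : Measurable ρ) (hρ0 : ∀ x, 0 ≤ ρ x) (hc : Convex ℝ (densitySupport ρ))
    (hb : Bornology.IsBounded (densitySupport ρ)) {a : ℝ}
    (ha : ∀ x ∈ densitySupport ρ, ρ x = a) : HasConditionalKernelBound ρ := by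
  obtain ⟨d, hd⟩ := Metric.isBounded_iff.1 hb
  refine ⟨fun _ => 1, ENNReal.ofReal d ^ 2 * 2 ^ n, measurable_const, by simp, by simp,
    ENNReal.mul_ne_top (by simp) (by simp), fun W hW k hk y hy => ?_⟩
  set K : Set (EuclideanSpace ℝ (Fin (n - k))) := {z | pointOf hk W y z ∈ densitySupport ρ}
  have hpt : Measurable fun z => pointOf hk W y z :=
    ((continuous_pointOf hk).comp (Continuous.prodMk continuous_const continuous_id)).measurable
  have hKm : MeasurableSet K := hpt (measurableSet_lt measurable_const hρ)
  have hKc : Convex ℝ K := by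
    intro z hz z' hz' s t hs ht hst
    have h := hc hz hz' hs ht hst
    have e : s • pointOf hk W y z + t • pointOf hk W y z' =
        pointOf hk W y (s • z + t • z') := by
      have e1 : pointOf hk W y z' = pointOf hk W y z + pointOf hk W 0 (z' - z) := by
        rw [← pointOf_add]; congr 1; abel
      have e2 : s • z + t • z' = z + t • (z' - z) := by
        rw [← eq_sub_iff_add_eq] at hst; rw [hst]; module
      rw [e1, e2, pointOf_add_smul, smul_add, ← add_assoc, ← add_smul, hst, one_smul]
    rw [e] at h
    exact h
  have hKd : ∀ z ∈ K, ∀ z' ∈ K, ‖z - z'‖ ≤ d := by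
    intro z hz z' hz'
    have h := hd hz hz'
    have e : pointOf hk W y z - pointOf hk W y z' = pointOf hk W 0 (z - z') := by
      rw [sub_eq_iff_eq_add', ← pointOf_add]; congr 1; abel
    rw [dist_eq_norm, e] at h
    have hn := norm_sq_pointOf hk hW 0 (z - z')
    rw [norm_zero, zero_pow two_ne_zero, zero_add] at hn
    rwa [(sq_eq_sq₀ (norm_nonneg _) (norm_nonneg _)).1 hn] at h
  have hr : (fun z => ENNReal.ofReal (condDensity hk W ρ y z)) =
      K.indicator fun _ => ENNReal.ofReal (a / activeDensity hk W ρ y) := by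
    funext z
    by_cases hz : z ∈ K
    · rw [Set.indicator_of_mem hz, condDensity, jointDensity, ha _ hz]
    · have : ρ (pointOf hk W y z) = 0 := le_antisymm (not_lt.1 hz) (hρ0 _)
      rw [Set.indicator_of_notMem hz, condDensity, jointDensity, this, zero_div,
        ENNReal.ofReal_zero]
  have hmass := (lintegral_condDensity hk hρ0 hy).le
  rw [hr]
  simp only [hr] at hmass
  refine fun p => (segmentKernelBound_of_convex hKc hKm hKd hmass p).trans ?_
  gcongr
  · norm_num
  · simp

/-- Since `‖W₁ y + W₂ z‖² = ‖y‖² + ‖z‖²`, the factor in `y` cancels and the conditional density is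
standard Gaussian for every `y`. The constant depends on the slice dimension only, and summing over
dimensions up to `n` makes it uniform in `k`. -/
theorem hasConditionalKernelBound_of_gaussian {n : ℕ} {ρ : EuclideanSpace ℝ (Fin n) → ℝ} {c : ℝ}
    (hρ : ∀ x, ρ x = c * Real.exp (-‖x‖ ^ 2 / 2)) : HasConditionalKernelBound ρ := by
  set I : ℕ → ℝ := fun m => ∫ v : EuclideanSpace ℝ (Fin m), Real.exp (-‖v‖ ^ 2 / 2)
  set C : ℕ → ENNReal := fun m => ENNReal.ofReal (64 * (I m)⁻¹) *
    (∫⁻ v : EuclideanSpace ℝ (Fin m), ENNReal.ofReal (Real.exp (-(1 / 8) * ‖v‖ ^ 2))) *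
      ∫⁻ s in Set.Ioo (0 : ℝ) 1, gaussianWeight s with hC
  have hI : ∀ m, 0 < I m := fun m => integral_exp_pos integrable_exp_neg_sq_norm_div_two
  refine ⟨gaussianWeight, ∑ m ∈ Finset.range (n + 1), C m, measurable_gaussianWeight,
    fun s hs => ⟨gaussianWeight_ne_zero hs, ENNReal.ofReal_ne_top⟩,
    lintegral_gaussianWeight_lt_top.ne, ?_, fun W hW k hk y hy => ?_⟩
  · refine ENNReal.sum_ne_top.2 fun m _ => ENNReal.mul_ne_top (ENNReal.mul_ne_top
      ENNReal.ofReal_ne_top ?_) lintegral_gaussianWeight_lt_top.ne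
    exact (lintegral_exp_neg_mul_sq_norm_lt_top (by norm_num)).ne
  · have hj : ∀ z, jointDensity hk W ρ y z =
        c * Real.exp (-‖y‖ ^ 2 / 2) * Real.exp (-‖z‖ ^ 2 / 2) := by
      intro z
      rw [jointDensity, hρ, norm_sq_pointOf hk hW, mul_assoc, ← Real.exp_add]
      congr 2
      ring
    have ha : activeDensity hk W ρ y = c * Real.exp (-‖y‖ ^ 2 / 2) * I (n - k) := by
      simp only [activeDensity, hj]
      rw [integral_const_mul]
    have hne : c * Real.exp (-‖y‖ ^ 2 / 2) ≠ 0 := by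
      intro h
      rw [ha, h, zero_mul] at hy
      exact lt_irrefl _ hy
    have hcd : ∀ z, condDensity hk W ρ y z = (I (n - k))⁻¹ * Real.exp (-‖z‖ ^ 2 / 2) := by
      intro z
      rw [condDensity, hj, ha, mul_div_mul_left _ _ hne, div_eq_inv_mul]
    simp only [hcd]
    refine fun p => (segmentKernelBound_gaussian (inv_nonneg.2 (hI _).le) p).trans ?_
    refine mul_le_mul_left ?_ _
    exact Finset.single_le_sum (f := C) (fun _ _ => zero_le)
      (Finset.mem_range.2 (by omega : n - k < n + 1))

/-- The law of `X` determines `ρ` only almost everywhere, while individual slices are null sets.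
Continuity of `ρ` on its open support upgrades the formula for `ρ` to every point. -/
theorem convex_and_hasConditionalKernelBound {n : ℕ} {Ω : Type*} [MeasurableSpace Ω]
    {P : Measure Ω} [IsProbabilityMeasure P] {X : Ω → EuclideanSpace ℝ (Fin n)}
    {ρ : EuclideanSpace ℝ (Fin n) → ℝ} (hρ : IsRegularDensity ρ)
    (hX : HasLaw X (volume.withDensity fun x => ENNReal.ofReal (ρ x)) P)
    (hcase :
      (Convex ℝ (densitySupport ρ) ∧ Bornology.IsBounded (densitySupport ρ) ∧
        pdf.IsUniform X (densitySupport ρ) P volume) ∨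
      (densitySupport ρ = Set.univ ∧
        HasLaw X (stdGaussian (EuclideanSpace ℝ (Fin n))) P)) :
    Convex ℝ (densitySupport ρ) ∧ HasConditionalKernelBound ρ := by
  have hrm : Measurable fun x => ENNReal.ofReal (ρ x) := hρ.measurable.ennreal_ofReal
  rcases hcase with ⟨hc, hb, hu⟩ | ⟨hU, hG⟩
  · refine ⟨hc, ?_⟩
    set U := densitySupport ρ
    have hUm : MeasurableSet U := hρ.isOpen_support.measurableSet
    have h1 : volume.withDensity (fun x => ENNReal.ofReal (ρ x)) =
        volume.withDensity (U.indicator fun _ => (volume U)⁻¹) := by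
      rw [← hX.map_eq, hu, withDensity_indicator hUm, withDensity_const, ProbabilityTheory.cond]
    rw [withDensity_eq_iff_of_sigmaFinite hrm.aemeasurable
      (measurable_const.indicator hUm).aemeasurable] at h1
    have h2 : ρ =ᵐ[volume.restrict U] fun _ => ((volume U)⁻¹).toReal := by
      rw [Filter.EventuallyEq, ae_restrict_iff' hUm]
      filter_upwards [h1] with x hx hxU
      rw [Set.indicator_of_mem hxU] at hx
      rw [← hx, ENNReal.toReal_ofReal (hρ.nonneg x)]
    exact hasConditionalKernelBound_of_const hρ.measurable hρ.nonneg hc hb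
      (Measure.eqOn_open_of_ae_eq h2 hρ.isOpen_support hρ.continuousOn continuousOn_const)
  · refine ⟨hU ▸ convex_univ, ?_⟩
    have h1 := hX.map_eq.symm.trans hG.map_eq
    rw [stdGaussian_eq_withDensity, withDensity_eq_iff_of_sigmaFinite hrm.aemeasurable
      (by fun_prop)] at h1
    have hcont : Continuous ρ := by
      have := hρ.continuousOn
      rwa [hU, continuousOn_univ] at this
    have h2 : ρ = fun x => (∫ v : EuclideanSpace ℝ (Fin n), Real.exp (-‖v‖ ^ 2 / 2))⁻¹ *
        Real.exp (-‖x‖ ^ 2 / 2) := by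
      refine Measure.eq_of_ae_eq (μ := volume) ?_ hcont (by fun_prop)
      filter_upwards [h1] with x hx
      refine (ENNReal.ofReal_eq_ofReal_iff (hρ.nonneg x) (mul_nonneg (inv_nonneg.2 ?_)
        (Real.exp_pos _).le)).1 hx
      exact integral_nonneg fun v => (Real.exp_pos _).le
    exact hasConditionalKernelBound_of_gaussian fun x => congrFun h2 x

end Densities

/-! ### Measurability and integrability of the gradient field -/

section Gradient

variable {n : ℕ}

/-- The gradient of `f` on `U`, extended by zero. -/
noncomputable def gradientField (f : EuclideanSpace ℝ (Fin n) → ℝ)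
    (U : Set (EuclideanSpace ℝ (Fin n))) (x : EuclideanSpace ℝ (Fin n)) :
    EuclideanSpace ℝ (Fin n) :=
  WithLp.toLp 2 fun i => U.indicator (partialDeriv f i) x

variable {f : EuclideanSpace ℝ (Fin n) → ℝ} {U : Set (EuclideanSpace ℝ (Fin n))}

theorem measurable_indicator_of_subtype (hU : MeasurableSet U)
    (hf : Measurable fun x : U => f x) : Measurable (U.indicator f) := by
  refine measurable_of_restrict_of_restrict_compl hU ?_ ?_
  · have : U.domRestrict (U.indicator f) = fun x : U => f x := by
      funext x
      exact Set.indicator_of_mem x.2 _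
    rw [this]
    exact hf
  · have : Uᶜ.domRestrict (U.indicator f) = fun _ => 0 := by
      funext x
      exact Set.indicator_of_notMem x.2 _
    rw [this]
    exact measurable_const

theorem hasDerivAt_indicator_line (hU : IsOpen U) (hp : ∀ x ∈ U, HasPartials f x)
    {x : EuclideanSpace ℝ (Fin n)} (hx : x ∈ U) (i : Fin n) :
    HasLineDerivAt ℝ (U.indicator f) (partialDeriv f i x) x (EuclideanSpace.single i (1 : ℝ)) :=
  (hp x hx i).hasLineDerivAt.congr_of_eventuallyEq
    (Filter.eventuallyEq_of_mem (hU.mem_nhds hx) fun _ hz => Set.indicator_of_mem hz _)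

/-- On `U` the partial derivative is the pointwise limit of difference quotients with steps `1 / (m
+ 1)`. Extending `f` by zero makes these measurable without affecting derivatives on the open set
`U`. -/
theorem measurable_indicator_partialDeriv (hU : IsOpen U) (hf : Measurable (U.indicator f))
    (hp : ∀ x ∈ U, HasPartials f x) (i : Fin n) :
    Measurable (U.indicator (partialDeriv f i)) := by
  set e : EuclideanSpace ℝ (Fin n) := EuclideanSpace.single i (1 : ℝ)
  set t : ℕ → ℝ := fun m => 1 / ((m : ℝ) + 1)
  have ht : Filter.Tendsto t Filter.atTop (nhdsWithin 0 {0}ᶜ) :=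
    tendsto_nhdsWithin_iff.2 ⟨tendsto_one_div_add_atTop_nhds_zero_nat,
      Filter.Eventually.of_forall fun m => (Nat.one_div_pos_of_nat (α := ℝ)).ne'⟩
  refine measurable_of_tendsto_metrizable (f := fun (m : ℕ) => U.indicator fun x =>
    (t m)⁻¹ * (U.indicator f (x + t m • e) - U.indicator f x)) (fun m => ?_) ?_
  · refine Measurable.indicator ?_ hU.measurableSet
    exact ((hf.comp (measurable_id.add_const _)).sub hf).const_mul _
  · refine tendsto_pi_nhds.2 fun x => ?_
    by_cases hx : x ∈ U
    · simp only [Set.indicator_of_mem (s := U) hx]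
      have h := (hasDerivAt_indicator_line hU hp hx i)
      rw [HasLineDerivAt, hasDerivAt_iff_tendsto_slope_zero] at h
      simpa [Function.comp_def, Set.indicator_of_mem (s := U) hx] using h.comp ht
    · simp only [Set.indicator_of_notMem (s := U) hx]
      exact tendsto_const_nhds

theorem measurable_gradientField (hU : IsOpen U) (hf : Measurable (U.indicator f))
    (hp : ∀ x ∈ U, HasPartials f x) : Measurable (gradientField f U) := by
  have := fun i => measurable_indicator_partialDeriv hU hf hp i
  unfold gradientField
  fun_prop

theorem integrable_gradientField_mul {ρ : EuclideanSpace ℝ (Fin n) → ℝ} (hρ : Measurable ρ)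
    (hρ0 : ∀ x, 0 ≤ ρ x) (hU : IsOpen U) (hG : Measurable (gradientField f U))
    (hi : ∀ i, IntegrableOn (fun x => partialDeriv f i x ^ 2 * ρ x) U) (i j : Fin n) :
    Integrable fun x => gradientField f U x i * gradientField f U x j * ρ x := by
  have hsq : ∀ i, Integrable fun x => gradientField f U x i ^ 2 * ρ x := fun i => by
    refine ((hi i).integrable_indicator hU.measurableSet).congr
      (Filter.Eventually.of_forall fun x => ?_)
    by_cases hx : x ∈ U <;> simp [gradientField, hx]
  have hm : ∀ i, Measurable fun x => gradientField f U x i := fun i =>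
    (by fun_prop : Measurable fun v : EuclideanSpace ℝ (Fin n) => v i).comp hG
  refine ((hsq i).add (hsq j)).mono' (((hm i).mul (hm j)).mul hρ).aestronglyMeasurable (Filter.Eventually.of_forall fun x => ?_)
  rw [Real.norm_eq_abs, abs_mul, abs_of_nonneg (hρ0 x), Pi.add_apply, ← add_mul]
  refine mul_le_mul_of_nonneg_right ?_ (hρ0 x)
  rw [abs_le]
  constructor <;> nlinarith [sq_nonneg (gradientField f U x i + gradientField f U x j),
    sq_nonneg (gradientField f U x i - gradientField f U x j)]

theorem gradientMatrix_apply {ρ : EuclideanSpace ℝ (Fin n) → ℝ}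
    (hU : IsOpen (densitySupport ρ)) (i j : Fin n) :
    gradientMatrix ρ f i j = ∫ x, gradientField f (densitySupport ρ) x i *
      gradientField f (densitySupport ρ) x j * ρ x := by
  rw [gradientMatrix, Matrix.of_apply, ← integral_indicator hU.measurableSet]
  refine integral_congr_ae (Filter.Eventually.of_forall fun x => ?_)
  by_cases hx : x ∈ densitySupport ρ <;> simp [gradientField, hx]

/-- On a compact subset of the support, `ρ` has a positive minimum, so the weighted square
integrability becomes unweighted, and `N ≤ 1 + N²` gives integrability. -/
theorem locallyIntegrableOn_gradientField {ρ : EuclideanSpace ℝ (Fin n) → ℝ}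
    (hρ : IsRegularDensity ρ) (hG : Measurable (gradientField f (densitySupport ρ)))
    (hi : ∀ i, IntegrableOn (fun x => partialDeriv f i x ^ 2 * ρ x) (densitySupport ρ)) :
    LocallyIntegrableOn (gradientField f (densitySupport ρ)) (densitySupport ρ) := by
  rw [locallyIntegrableOn_iff hρ.isOpen_support.isLocallyClosed]
  intro K hKU hK
  rcases K.eq_empty_or_nonempty with rfl | hne
  · simp
  obtain ⟨x₀, hx₀, hmin⟩ := hK.exists_isMinOn hne (hρ.continuousOn.mono hKU)
  have hε : 0 < ρ x₀ := hKU hx₀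
  have hS : Integrable fun x => ∑ i, gradientField f (densitySupport ρ) x i *
      gradientField f (densitySupport ρ) x i * ρ x :=
    integrable_finsetSum _ fun i _ =>
      integrable_gradientField_mul hρ.measurable hρ.nonneg hρ.isOpen_support hG hi i i
  have hone : IntegrableOn (fun _ : EuclideanSpace ℝ (Fin n) => (1 : ℝ)) K :=
    integrableOn_const hK.measure_ne_top
  refine Integrable.mono' (hone.add (hS.integrableOn.const_mul (ρ x₀)⁻¹))
    hG.aestronglyMeasurable ?_
  rw [ae_restrict_iff' hK.measurableSet]
  refine Filter.Eventually.of_forall fun x hx => ?_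
  have h1 : ρ x₀ ≤ ρ x := hmin hx
  have h2 : ∑ i, gradientField f (densitySupport ρ) x i *
      gradientField f (densitySupport ρ) x i * ρ x =
      ‖gradientField f (densitySupport ρ) x‖ ^ 2 * ρ x := by
    rw [EuclideanSpace.norm_sq_eq, Finset.sum_mul]
    simp [← sq]
  simp only [Pi.add_apply]
  rw [h2]
  set N := ‖gradientField f (densitySupport ρ) x‖
  have h3 : N ^ 2 ≤ (ρ x₀)⁻¹ * (N ^ 2 * ρ x) := by
    rw [← div_eq_inv_mul, le_div_iff₀ hε]
    exact mul_le_mul_of_nonneg_left h1 (sq_nonneg _)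
  nlinarith [sq_nonneg (N - 1)]

theorem lineFTC_gradientField (hU : IsOpen U) (hc : Convex ℝ U)
    (hf : Measurable (U.indicator f)) (hp : ∀ x ∈ U, HasPartials f x)
    (hG : LocallyIntegrableOn (gradientField f U) U) (u : EuclideanSpace ℝ (Fin n)) :
    LineFTC U (U.indicator f) (gradientField f U) u := by
  have hGm := measurable_gradientField hU hf hp
  refine lineFTC_of_span hU hc hf hGm hG (S := Set.range (EuclideanSpace.basisFun (Fin n) ℝ))
    (by
      have := (EuclideanSpace.basisFun (Fin n) ℝ).toBasis.span_eq
      rwa [OrthonormalBasis.coe_toBasis] at this) ?_ u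
  rintro _ ⟨i, rfl⟩ t
  refine lineFTC_of_hasDerivAt hU hc hGm hG _ fun x hx => ?_
  rw [EuclideanSpace.basisFun_apply]
  have h := (hasDerivAt_indicator_line hU hp hx i).smul t
  have e : (inner ℝ (gradientField f U x) (t • EuclideanSpace.single i (1 : ℝ)) : ℝ) =
      t • partialDeriv f i x := by
    rw [inner_smul_right, EuclideanSpace.inner_single_right]
    simp [gradientField, Set.indicator_of_mem hx]
  rw [e]
  exact h

end Gradient

/-! ### The discarded eigenvalues as a mean square -/

section Eigenvalues

variable {n k : ℕ} (hk : k < n)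

/-- This is the `i`-th diagonal entry of `Wᵀ C W = Λ`. -/
theorem IsOrthogonalEigendecomposition.sum_sum_eq {C W : Matrix (Fin n) (Fin n) ℝ}
    {lam : Fin n → ℝ} (h : IsOrthogonalEigendecomposition C W lam) (i : Fin n) :
    ∑ a, ∑ b, W a i * W b i * C a b = lam i := by
  have h1 : Wᵀ * W = 1 := by
    have := (Matrix.mem_orthogonalGroup_iff' (Fin n) ℝ).1 h.orthogonal
    simpa [Matrix.star_eq_conjTranspose] using this
  have h2 : Wᵀ * C * W = Matrix.diagonal lam := by
    rw [h.eq_mul]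
    calc Wᵀ * (W * Matrix.diagonal lam * Wᵀ) * W
        = (Wᵀ * W) * Matrix.diagonal lam * (Wᵀ * W) := by simp only [Matrix.mul_assoc]
      _ = Matrix.diagonal lam := by rw [h1, Matrix.one_mul, Matrix.mul_one]
  have h3 := congrFun (congrFun h2 i) i
  rw [Matrix.diagonal_apply_eq] at h3
  rw [← h3, Matrix.mul_apply, Finset.sum_comm]
  refine Finset.sum_congr rfl fun b _ => ?_
  rw [Matrix.mul_apply, Finset.sum_mul]
  refine Finset.sum_congr rfl fun a _ => ?_
  rw [Matrix.transpose_apply]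
  ring

theorem sum_inactive_eq_sum_filter (lam : Fin n → ℝ) :
    ∑ j : Fin (n - k), lam ⟨k + j, by omega⟩ =
      ∑ i ∈ Finset.univ.filter (fun i : Fin n => k ≤ (i : ℕ)), lam i := by
  refine Finset.sum_bij' (fun j _ => ⟨k + j, by omega⟩) (fun i _ => ⟨(i : ℕ) - k, by omega⟩)
    ?_ ?_ ?_ ?_ ?_
  · simp
  · simp
  · intro j _
    simp
  · intro i hi
    have := (Finset.mem_filter.1 hi).2
    ext
    simp
    omega
  · simp

/-- The mean square of the gradient in the inactive directions is the sum of the discarded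
eigenvalues. -/
theorem integrable_and_integral_norm_inactiveVariable_sq {f ρ : EuclideanSpace ℝ (Fin n) → ℝ}
    (hρ : IsRegularDensity ρ) (hG : Measurable (gradientField f (densitySupport ρ)))
    (hi : ∀ i, IntegrableOn (fun x => partialDeriv f i x ^ 2 * ρ x) (densitySupport ρ))
    {W : Matrix (Fin n) (Fin n) ℝ} {lam : Fin n → ℝ}
    (h : IsOrthogonalEigendecomposition (gradientMatrix ρ f) W lam) :
    Integrable (fun x =>
        ‖inactiveVariable hk W (gradientField f (densitySupport ρ) x)‖ ^ 2 * ρ x) ∧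
      ∫ x, ‖inactiveVariable hk W (gradientField f (densitySupport ρ) x)‖ ^ 2 * ρ x =
        ∑ i ∈ Finset.univ.filter (fun i : Fin n => k ≤ (i : ℕ)), lam i := by
  set G := gradientField f (densitySupport ρ)
  have hint := integrable_gradientField_mul hρ.measurable hρ.nonneg hρ.isOpen_support hG hi
  have hexp : (fun x => ‖inactiveVariable hk W (G x)‖ ^ 2 * ρ x) = fun x =>
      ∑ j : Fin (n - k), ∑ a, ∑ b, W a ⟨k + j, by omega⟩ * W b ⟨k + j, by omega⟩ *
        (G x a * G x b * ρ x) := by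
    funext x
    rw [EuclideanSpace.norm_sq_eq, Finset.sum_mul]
    refine Finset.sum_congr rfl fun j _ => ?_
    have : (inactiveVariable hk W (G x)) j = ∑ a, W a ⟨k + j, by omega⟩ * G x a := by
      simp [inactiveVariable, inactiveColumns, Matrix.mulVec, dotProduct]
    rw [this, Real.norm_eq_abs, sq_abs, sq, Finset.sum_mul_sum, Finset.sum_mul]
    refine Finset.sum_congr rfl fun a _ => ?_
    rw [Finset.sum_mul]
    refine Finset.sum_congr rfl fun b _ => ?_
    ring
  have h1 : ∀ (j : Fin (n - k)) (a b : Fin n), Integrable fun x =>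
      W a ⟨k + j, by omega⟩ * W b ⟨k + j, by omega⟩ * (G x a * G x b * ρ x) :=
    fun j a b => (hint a b).const_mul _
  have h2 : ∀ (j : Fin (n - k)) (a : Fin n), Integrable fun x =>
      ∑ b, W a ⟨k + j, by omega⟩ * W b ⟨k + j, by omega⟩ * (G x a * G x b * ρ x) :=
    fun j a => integrable_finsetSum _ fun b _ => h1 j a b
  have h3 : ∀ (j : Fin (n - k)), Integrable fun x =>
      ∑ a, ∑ b, W a ⟨k + j, by omega⟩ * W b ⟨k + j, by omega⟩ * (G x a * G x b * ρ x) :=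
    fun j => integrable_finsetSum _ fun a _ => h2 j a
  rw [hexp]
  refine ⟨integrable_finsetSum _ fun j _ => h3 j, ?_⟩
  rw [integral_finsetSum _ fun j _ => h3 j, ← sum_inactive_eq_sum_filter hk]
  refine Finset.sum_congr rfl fun j _ => ?_
  rw [← h.sum_sum_eq, integral_finsetSum _ fun a _ => h2 j a]
  refine Finset.sum_congr rfl fun a _ => ?_
  rw [integral_finsetSum _ fun b _ => h1 j a b]
  refine Finset.sum_congr rfl fun b _ => ?_
  rw [integral_const_mul, gradientMatrix_apply hρ.isOpen_support]

end Eigenvalues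

/-! ### The ridge approximation bound -/

theorem mainTheorem6 {n : ℕ} {Ω : Type*} [MeasurableSpace Ω] (P : Measure Ω)
    [IsProbabilityMeasure P] (X : Ω → EuclideanSpace ℝ (Fin n))
    (ρ : EuclideanSpace ℝ (Fin n) → ℝ) (hρ : IsRegularDensity ρ)
    (hX : HasLaw X (volume.withDensity fun x => ENNReal.ofReal (ρ x)) P)
    (hcase :
      (Convex ℝ (densitySupport ρ) ∧ Bornology.IsBounded (densitySupport ρ) ∧
        pdf.IsUniform X (densitySupport ρ) P volume) ∨
      (densitySupport ρ = Set.univ ∧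
        HasLaw X (stdGaussian (EuclideanSpace ℝ (Fin n))) P)) :
    ∃ C : ℝ, 0 < C ∧
      ∀ (f : EuclideanSpace ℝ (Fin n) → ℝ),
        Measurable (fun x : densitySupport ρ => f x) →
        (∀ x ∈ densitySupport ρ, HasPartials f x) →
        (∀ i, IntegrableOn (fun x => partialDeriv f i x ^ 2 * ρ x) (densitySupport ρ)) →
        ∀ (W : Matrix (Fin n) (Fin n) ℝ) (lam : Fin n → ℝ),
          IsOrthogonalEigendecomposition (gradientMatrix ρ f) W lam →
          ∀ (k : ℕ) (_ : 1 ≤ k) (hk : k < n),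
            (∀ᵐ ω ∂P, Integrable fun z : EuclideanSpace ℝ (Fin (n - k)) =>
              f (pointOf hk W (activeVariable hk W (X ω)) z) *
                condDensity hk W ρ (activeVariable hk W (X ω)) z) ∧
            Integrable (fun ω => (f (X ω) - ridgeApprox hk W ρ f (X ω)) ^ 2) P ∧
            ∫ ω, (f (X ω) - ridgeApprox hk W ρ f (X ω)) ^ 2 ∂P ≤
              C * ∑ i ∈ Finset.univ.filter (fun i : Fin n => k ≤ (i : ℕ)), lam i := by
  obtain ⟨hc, w, C, hw, h0, hκ, hC, hker⟩ := convex_and_hasConditionalKernelBound hρ hX hcase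
  set A := (∫⁻ s in Set.Ioo (0 : ℝ) 1, w s) * C with hA
  have hAtop : A ≠ ⊤ := ENNReal.mul_ne_top hκ hC
  -- Adding `1` ensures positivity, as `A` may vanish; it is harmless at the end because `L ≥ 0`.
  refine ⟨A.toReal + 1, by positivity, ?_⟩
  intro f hfm hp hi W lam hdec k _ hk
  have hW := hdec.orthogonal
  have hU := hρ.isOpen_support
  have hrm : Measurable fun x => ENNReal.ofReal (ρ x) := hρ.measurable.ennreal_ofReal
  set F := (densitySupport ρ).indicator f with hFdef
  have hF : Measurable F := measurable_indicator_of_subtype hU.measurableSet hfm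
  set G := gradientField f (densitySupport ρ)
  have hG : Measurable G := measurable_gradientField hU hF hp
  have hftc := lineFTC_gradientField hU hc hF hp (locallyIntegrableOn_gradientField hρ hG hi)
  obtain ⟨hTi, hT⟩ := integrable_and_integral_norm_inactiveVariable_sq hk hρ hG hi hdec
  set L := ∑ i ∈ Finset.univ.filter (fun i : Fin n => k ≤ (i : ℕ)), lam i
  have hT0 : ∀ x, 0 ≤ ‖inactiveVariable hk W (G x)‖ ^ 2 * ρ x := fun x =>
    mul_nonneg (sq_nonneg _) (hρ.nonneg x)
  have hL0 : 0 ≤ L := hT ▸ integral_nonneg hT0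
  have hTl : ∫⁻ x, ‖inactiveVariable hk W (G x)‖ₑ ^ 2 * ENNReal.ofReal (ρ x) =
      ENNReal.ofReal L := by
    rw [← hT, ofReal_integral_eq_lintegral_ofReal hTi (Filter.Eventually.of_forall hT0)]
    refine lintegral_congr fun x => ?_
    rw [ENNReal.ofReal_mul (sq_nonneg _), ENNReal.ofReal_pow (norm_nonneg _), ofReal_norm]
  have hρfin : ∫⁻ x, ENNReal.ofReal (ρ x) ≠ ⊤ := by
    have h1 : P.map X Set.univ = ∫⁻ x, ENNReal.ofReal (ρ x) := by
      rw [hX.map_eq, withDensity_apply _ MeasurableSet.univ, Measure.restrict_univ]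
    rw [← h1, Measure.map_apply_of_aemeasurable hX.aemeasurable MeasurableSet.univ]
    exact measure_ne_top _ _
  obtain ⟨hint, hbound⟩ := conditional_poincare hk hW hρ.measurable hρ.nonneg hρfin hF hG hftc
    hw h0 hκ hC (hker W hW k hk) (by rw [hTl]; exact ENNReal.ofReal_ne_top)
  rw [hTl, ← hA] at hbound
  -- Values of `f` off the support are arbitrary, but there the conditional density vanishes, so `f`
  -- and its extension by zero have the same conditional mean.
  have hfF : ∀ (y : EuclideanSpace ℝ (Fin k)) (z : EuclideanSpace ℝ (Fin (n - k))),
      f (pointOf hk W y z) * condDensity hk W ρ y z =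
        F (pointOf hk W y z) * condDensity hk W ρ y z := by
    intro y z
    by_cases hz : pointOf hk W y z ∈ densitySupport ρ
    · rw [hFdef, Set.indicator_of_mem hz]
    · have : ρ (pointOf hk W y z) = 0 := le_antisymm (not_lt.1 hz) (hρ.nonneg _)
      simp [condDensity, jointDensity, this]
  have hridge : ridgeApprox hk W ρ f = ridgeApprox hk W ρ F := by
    funext x
    simp only [ridgeApprox, condMean, hfF]
  -- Almost sure statements about `X` need checking only where `ρ ≠ 0`, which is where `f` and `F`
  -- agree.
  have hae : ∀ {p : EuclideanSpace ℝ (Fin n) → Prop},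
      (∀ᵐ x, ENNReal.ofReal (ρ x) ≠ 0 → p x) → ∀ᵐ ω ∂P, p (X ω) := by
    intro p h
    refine ae_of_ae_map hX.aemeasurable ?_
    rwa [hX.map_eq, ae_withDensity_iff hrm]
  refine ⟨?_, ?_⟩
  · simp only [hfF]
    exact hae ((ae_activeVariable hk hW hint).mono fun x hx _ => hx)
  set Ψ : EuclideanSpace ℝ (Fin n) → ℝ := fun x => (F x - ridgeApprox hk W ρ F x) ^ 2
  have hΨ : Measurable Ψ :=
    (hF.sub (measurable_ridgeApprox hk hρ.measurable hF)).pow_const 2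
  have hcongr : (fun ω => (f (X ω) - ridgeApprox hk W ρ f (X ω)) ^ 2) =ᵐ[P] fun ω => Ψ (X ω) := by
    refine hae (p := fun x => (f x - ridgeApprox hk W ρ f x) ^ 2 = Ψ x)
      (Filter.Eventually.of_forall fun x hx => ?_)
    have hxU : x ∈ densitySupport ρ := show 0 < ρ x by simpa using hx
    simp only [Ψ, hridge, hFdef, Set.indicator_of_mem hxU]
  have hlin : ∫⁻ ω, ENNReal.ofReal (Ψ (X ω)) ∂P ≤ A * ENNReal.ofReal L := by
    refine le_trans (le_of_eq ?_) hbound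
    rw [← lintegral_map' (f := fun x => ENNReal.ofReal (Ψ x)) (by fun_prop) hX.aemeasurable,
      hX.map_eq, lintegral_withDensity_eq_lintegral_mul _ hrm (by fun_prop)]
    refine lintegral_congr fun x => ?_
    have : Ψ x = (F x - ridgeApprox hk W ρ F x) ^ 2 := rfl
    rw [Pi.mul_apply, mul_comm, this, ← sq_abs, ENNReal.ofReal_pow (abs_nonneg _),
      ← Real.enorm_eq_ofReal_abs]
  have hfin : A * ENNReal.ofReal L ≠ ⊤ := ENNReal.mul_ne_top hAtop ENNReal.ofReal_ne_top
  have hΨX : AEStronglyMeasurable (fun ω => Ψ (X ω)) P :=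
    (hΨ.comp_aemeasurable hX.aemeasurable).aestronglyMeasurable
  have hΨ0 : 0 ≤ᵐ[P] fun ω => Ψ (X ω) := Filter.Eventually.of_forall fun ω => sq_nonneg _
  refine ⟨Integrable.congr ⟨hΨX, ?_⟩ hcongr.symm, ?_⟩
  · rw [hasFiniteIntegral_iff_ofReal hΨ0]
    exact hlin.trans_lt hfin.lt_top
  · rw [integral_congr_ae hcongr, integral_eq_lintegral_of_nonneg_ae hΨ0 hΨX]
    calc (∫⁻ ω, ENNReal.ofReal (Ψ (X ω)) ∂P).toReal ≤ (A * ENNReal.ofReal L).toReal :=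
          ENNReal.toReal_mono hfin hlin
      _ = A.toReal * L := by rw [ENNReal.toReal_mul, ENNReal.toReal_ofReal hL0]
      _ ≤ (A.toReal + 1) * L := by nlinarith
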